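/- Let $d\ge 1$, let $\Omega\subset\mathbb R^d$ be measurable and let $\sigma:\Omega\to\mathbb R$ be measurable. Put $a_\sigma(e)=\mathrm{meas}\{x\in\Omega:\sigma(x)<e\}$ for $e\in\mathbb R$, assume that $\{e\in\mathbb R: a_\sigma(e)<\mathrm{meas}(\Omega)\}\neq\varnothing$, and put $e_{\max}=\sup\{e\in\mathbb R: a_\sigma(e)<\mathrm{meas}(\Omega)\}\in(-\infty,+\infty]$ and $e_{\min}=\operatorname{ess\,inf}_\Omega\sigma$. Assume $e_{\min}<e_{\max}$, $\mathrm{meas}\{x\in\Omega:\sigma(x)=e\}=0$ for every real $e<e_{\max}$, and $a_\sigma(e)\to\mathrm{meas}(\Omega)$ as $e\to e_{\max}$, $e<e_{\max}$. Put $b_\sigma(\mu)=\sup\{t<e_{\max}: a_\sigma(t)\le\mu\}$ for $\mu\ge0$, with $\sup\varnothing=-\infty$. For a nonnegative $q\in L^1(\Omega)$ let $\mu_q(t)=\mathrm{meas}\{x\in\Omega:q(x)>t\}$, $q^\sharp(s)=\inf\{t\ge0:\mu_q(t)\le s\}$, $q^*(x)=q^\sharp(\mathrm{meas}(B(0,|x|)\cap\Omega))$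 and $q^{*\sigma}(x)=q^\sharp(a_\sigma(\sigma(x)))\mathbf 1_{\sigma(x)<e_{\max}}$. For nonnegative $f,g\in L^1(\Omega)$ let $\beta_{f,g}(s)=\mathrm{meas}\{x\in\Omega: f(x)\le s<g(x)\}$. Assume that $B_\sigma(\mu)=\int_{\{a_\sigma(\sigma(x))<\mu\}}\sigma(x)\,dx$ is well defined and finite for every $\mu\in[0,\mathrm{meas}(\Omega))$. If $\mathrm{meas}(\Omega)<\infty$, continue $B_\sigma$ to $\mu\ge\mathrm{meas}(\Omega)$ by $B_\sigma(\mu)=\int_\Omega\sigma\,dx+e_{\max}\,(\mu-\mathrm{meas}(\Omega))\in(-\infty,+\infty]$, that is, with slope $b_\sigma(\mu)=e_{\max}$. For $0<\mu<\infty$ let $$H_\sigma(\mu)=\inf_{0<s\le\mu}\frac{B_\sigma(\mu+s)+B_\sigma(\mu-s)-2B_\sigma(\mu)}{s^2},\qquad K(q^*,\sigma)=4\int_0^{\|q\|_{L^\infty}}\frac{dt}{H_\sigma(\mu_q(t))}\in[0,+\infty],$$ where $0\cdot(\pm\infty)=0$, $1/0=+\infty$, $1/(+\infty)=0$, and $1/H_\sigma(\mu)=+\infty$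 if $B_\sigma(\mu)=+\infty$. For nonnegative $f,q\in L^1(\Omega)$ write $$I=\int_\Omega\sigma\,(f-q^{*\sigma})\,dx,\qquad C=\int_0^\infty\big[\beta_{f^*,q^*}(s)\,b_\sigma(2\mu_q(s))-\beta_{q^*,f^*}(s)\,b_\sigma(\mu_q(s))\big]ds,$$ and suppose that the positive parts of the two integrands have finite integrals, so that $I,C\in[-\infty,+\infty)$ (otherwise the right-hand sides below are $+\infty$ or undefined). Then: (i) $B_\sigma$ is convex on $[0,\mathrm{meas}(\Omega))$. (ii) For every nonzero nonnegative $q\in L^1(\Omega)$ with $K(q^*,\sigma)<\infty$ and every such $f$, $$\big(\|f-q^{*\sigma}\|_{L^1(\Omega)}+\|q\|_{L^1(\Omega)}-\|f\|_{L^1(\Omega)}\big)^2\le K(q^*,\sigma)\,[\,I+C\,].$$ In particular, for every nonnegative $f\in L^1(\Omega)$ with $K(f^*,\sigma)<\infty$ for which the positive part of $\sigma(f-f^{*\sigma})$ is integrable, $$\|f-f^{*\sigma}\|_{L^1(\Omega)}^2\le K(f^*,\sigma)\int_\Omega\sigma\,(f-f^{*\sigma})\,dx .$$ (iii) For all such $f,q$,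 whether or not $K(q^*,\sigma)$ is finite, with $\beta=\beta_{f,q^{*\sigma}}$, $$I\ \ge\ \int_0^\infty\big[B_\sigma(\mu_q(s)+\beta(s))+B_\sigma(\mu_q(s)-\beta(s))-2B_\sigma(\mu_q(s))\big]ds\;-\;C,$$ provided $B_\sigma(\mu_q(s))$ is finite for almost every $s>0$ (automatic if $\mathrm{meas}(\Omega)=\infty$). -/

import Mathlib

open MeasureTheory Set Filter Topology
open scoped ENNReal NNReal

namespace RefinedHL

noncomputable section

/-- The Lebesgue integral with values in the extended reals: integral of the positive part minus
integral of the negative part. It is the usual one as soon as one of the two is finite. -/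
def extIntegral {α : Type*} [MeasurableSpace α] (ν : Measure α) (g : α → EReal) : EReal :=
  ((∫⁻ x, (g x).toENNReal ∂ν : ℝ≥0∞) : EReal) - ((∫⁻ x, (-g x).toENNReal ∂ν : ℝ≥0∞) : EReal)

/-- The positive part of `g` has a finite integral, i.e. the integral of `g` makes sense in
`[-∞, +∞)`. -/
def PosPartIntegrable {α : Type*} [MeasurableSpace α] (ν : Measure α) (g : α → EReal) : Prop :=
  ∫⁻ x, (g x).toENNReal ∂ν ≠ ⊤

variable {d : ℕ}

/-- The distribution function `μ_q(t) = meas {x ∈ Ω : q(x) > t}`. -/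
def distrib (Ω : Set (EuclideanSpace ℝ (Fin d))) (q : EuclideanSpace ℝ (Fin d) → ℝ) (t : ℝ) :
    ℝ≥0∞ :=
  volume {x | x ∈ Ω ∧ t < q x}

/-- The pseudo-inverse `q♯(s) = inf {t ≥ 0 : μ_q(t) ≤ s}`, with values in `[0, +∞]`. -/
def sharp (Ω : Set (EuclideanSpace ℝ (Fin d))) (q : EuclideanSpace ℝ (Fin d) → ℝ) (s : ℝ≥0∞) :
    ℝ≥0∞ :=
  sInf ((fun t : ℝ≥0 => (t : ℝ≥0∞)) '' {t : ℝ≥0 | distrib Ω q t ≤ s})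

/-- The rearrangement `q*(x) = q♯(meas (B(0,|x|) ∩ Ω))`. The value `q♯ = +∞`, which is possible
only on a null set, is replaced by `0`. -/
def rearr (Ω : Set (EuclideanSpace ℝ (Fin d))) (q : EuclideanSpace ℝ (Fin d) → ℝ)
    (x : EuclideanSpace ℝ (Fin d)) : ℝ :=
  (sharp Ω q (volume (Metric.ball (0 : EuclideanSpace ℝ (Fin d)) ‖x‖ ∩ Ω))).toReal

/-- `β_{f,g}(s) = meas {x ∈ Ω : f(x) ≤ s < g(x)}`. -/
def beta (Ω : Set (EuclideanSpace ℝ (Fin d))) (f g : EuclideanSpace ℝ (Fin d) → ℝ) (s : ℝ) :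
    ℝ≥0∞ :=
  volume {x | x ∈ Ω ∧ f x ≤ s ∧ s < g x}

/-- `a_σ(e) = meas {x ∈ Ω : σ(x) < e}`. -/
def jac (Ω : Set (EuclideanSpace ℝ (Fin d))) (σ : EuclideanSpace ℝ (Fin d) → ℝ) (e : ℝ) : ℝ≥0∞ :=
  volume {x | x ∈ Ω ∧ σ x < e}

/-- `e_min`, the essential infimum of `σ` on `Ω`. -/
def eMin (Ω : Set (EuclideanSpace ℝ (Fin d))) (σ : EuclideanSpace ℝ (Fin d) → ℝ) : EReal :=
  essInf (fun x => (σ x : EReal)) (volume.restrict Ω)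

/-- `e_max = sup {e ∈ ℝ : a_σ(e) < meas Ω}`. -/
def eMax (Ω : Set (EuclideanSpace ℝ (Fin d))) (σ : EuclideanSpace ℝ (Fin d) → ℝ) : EReal :=
  sSup ((fun e : ℝ => (e : EReal)) '' {e : ℝ | jac Ω σ e < volume Ω})

/-- The standing assumptions on `Ω` and `σ` under which the `σ`-rearrangement is defined.
Measurability is Lebesgue measurability. -/
structure Admissible (Ω : Set (EuclideanSpace ℝ (Fin d)))
    (σ : EuclideanSpace ℝ (Fin d) → ℝ) : Prop where
  measurable_domain : NullMeasurableSet Ω volume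
  measurable_fun : AEMeasurable σ (volume.restrict Ω)
  nonempty : {e : ℝ | jac Ω σ e < volume Ω}.Nonempty
  eMin_lt_eMax : eMin Ω σ < eMax Ω σ
  level_null : ∀ e : ℝ, (e : EReal) < eMax Ω σ → volume {x | x ∈ Ω ∧ σ x = e} = 0
  tendsto_jac : Tendsto (jac Ω σ)
    (comap (fun e : ℝ => (e : EReal)) (𝓝[<] (eMax Ω σ))) (𝓝 (volume Ω))

open Classical in
/-- The `σ`-rearrangement `q^{*σ}(x) = q♯(a_σ(σ(x))) 1_{σ(x) < e_max}`. The value `q♯ = +∞`, which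
is possible only on a null set, is replaced by `0`. -/
def sigmaRearr (Ω : Set (EuclideanSpace ℝ (Fin d))) (σ q : EuclideanSpace ℝ (Fin d) → ℝ)
    (x : EuclideanSpace ℝ (Fin d)) : ℝ :=
  if (σ x : EReal) < eMax Ω σ then (sharp Ω q (jac Ω σ (σ x))).toReal else 0

/-- The pseudo-inverse `b_σ(μ) = sup {t < e_max : a_σ(t) ≤ μ}`, equal to `-∞` if the set is
empty. -/
def jacInv (Ω : Set (EuclideanSpace ℝ (Fin d))) (σ : EuclideanSpace ℝ (Fin d) → ℝ) (μ : ℝ≥0∞) :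
    EReal :=
  sSup ((fun t : ℝ => (t : EReal)) '' {t : ℝ | (t : EReal) < eMax Ω σ ∧ jac Ω σ t ≤ μ})

/-- The set `{x ∈ Ω : a_σ(σ(x)) < μ}`. -/
def sublevel (Ω : Set (EuclideanSpace ℝ (Fin d))) (σ : EuclideanSpace ℝ (Fin d) → ℝ) (μ : ℝ≥0∞) :
    Set (EuclideanSpace ℝ (Fin d)) :=
  {x | x ∈ Ω ∧ jac Ω σ (σ x) < μ}

/-- `B_σ(μ) = ∫_{a_σ(σ(x)) < μ} σ(x) dx` for `0 ≤ μ < meas Ω`. -/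
def bigB (Ω : Set (EuclideanSpace ℝ (Fin d))) (σ : EuclideanSpace ℝ (Fin d) → ℝ) (μ : ℝ≥0∞) : ℝ :=
  ∫ x in sublevel Ω σ μ, σ x

open Classical in
/-- `B_σ` on all of `[0, +∞)`. If `meas Ω` is finite, `B_σ` is continued to `μ ≥ meas Ω` by
`∫_Ω σ + e_max (μ - meas Ω)`, that is, with slope `b_σ(μ) = e_max` there. Nothing is added
if `meas Ω = +∞`. -/
def bigBExt (Ω : Set (EuclideanSpace ℝ (Fin d))) (σ : EuclideanSpace ℝ (Fin d) → ℝ) (μ : ℝ≥0∞) :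
    EReal :=
  if μ < volume Ω then (bigB Ω σ μ : EReal)
  else extIntegral (volume.restrict Ω) (fun x => (σ x : EReal))
    + eMax Ω σ * ((μ - volume Ω : ℝ≥0∞) : EReal)

/-- `B_σ(μ + s) + B_σ(μ - s) - 2 B_σ(μ)`, for `0 ≤ s ≤ μ`. -/
def secondDiff (Ω : Set (EuclideanSpace ℝ (Fin d))) (σ : EuclideanSpace ℝ (Fin d) → ℝ)
    (μ s : ℝ≥0∞) : EReal :=
  bigBExt Ω σ (μ + s) + bigBExt Ω σ (μ - s) - 2 * bigBExt Ω σ μ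

/-- `H_σ(μ) = inf_{0 < s ≤ μ} (B_σ(μ + s) + B_σ(μ - s) - 2 B_σ(μ)) / s²`. -/
def bigH (Ω : Set (EuclideanSpace ℝ (Fin d))) (σ : EuclideanSpace ℝ (Fin d) → ℝ) (μ : ℝ≥0∞) :
    EReal :=
  ⨅ s ∈ Ioc (0 : ℝ≥0∞) μ, secondDiff Ω σ μ s / ((s : EReal) ^ 2)

/-- `K(q*, σ) = 4 ∫_0^{‖q‖_∞} dt / H_σ(μ_q(t))` in `[0, +∞]`, with `1/0 = +∞` and `1/(+∞) = 0`. -/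
def bigK (Ω : Set (EuclideanSpace ℝ (Fin d))) (σ q : EuclideanSpace ℝ (Fin d) → ℝ) : ℝ≥0∞ :=
  4 * ∫⁻ t in {t : ℝ | 0 < t ∧ ENNReal.ofReal t < eLpNorm q ⊤ (volume.restrict Ω)},
    ((bigH Ω σ (distrib Ω q t)).toENNReal)⁻¹

/-- The integrand `β_{f*,q*}(s) b_σ(2 μ_q(s)) - β_{q*,f*}(s) b_σ(μ_q(s))`. At most one of the two
factors `β` is nonzero, and `0 · (±∞) = 0`. -/
def correction (Ω : Set (EuclideanSpace ℝ (Fin d))) (σ f q : EuclideanSpace ℝ (Fin d) → ℝ)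
    (s : ℝ) : EReal :=
  (beta Ω (rearr Ω f) (rearr Ω q) s : EReal) * jacInv Ω σ (2 * distrib Ω q s)
    - (beta Ω (rearr Ω q) (rearr Ω f) s : EReal) * jacInv Ω σ (distrib Ω q s)

/-- The integrand `σ(x) (f(x) - q^{*σ}(x))`. -/
def energyDiff (Ω : Set (EuclideanSpace ℝ (Fin d))) (σ f q : EuclideanSpace ℝ (Fin d) → ℝ)
    (x : EuclideanSpace ℝ (Fin d)) : EReal :=
  ((σ x * (f x - sigmaRearr Ω σ q x) : ℝ) : EReal)

/-- `f` is a nonnegative element of `L¹(Ω)`. -/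
def NonnegL1 (Ω : Set (EuclideanSpace ℝ (Fin d))) (f : EuclideanSpace ℝ (Fin d) → ℝ) : Prop :=
  IntegrableOn f Ω volume ∧ 0 ≤ᵐ[volume.restrict Ω] f

/-- The norm of `L¹(Ω)`. -/
def normL1 (Ω : Set (EuclideanSpace ℝ (Fin d))) (f : EuclideanSpace ℝ (Fin d) → ℝ) : ℝ :=
  ∫ x in Ω, |f x|

end

end RefinedHL

open RefinedHL

/-! Everything rests on one duality. Put `excess e` $=\int_\Omega(e-\sigma)_+$, whose increments are
governed by the slopes $a_\sigma$. Since $e-\sigma\le(e-\sigma)_+$, every set $A\subset\Omega$ of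
finite measure on which $\sigma$ is integrable satisfies the bathtub inequality
$e|A|-\int_\Omega(e-\sigma)_+\le\int_A\sigma$ for each $e<e_{\max}$, with equality for
$A=\{\sigma<e\}$. So $B_\sigma$ is the Legendre transform of `excess` on $(-\infty,e_{\max})$, and
$B_\sigma(|A|)\le\int_A\sigma$. The extension of $B_\sigma$ beyond $|\Omega|$ with slope $e_{\max}$
is the same supremum of affine functions (`bigBExt_eq`), so convexity and slope bounds hold
uniformly.

Fix a height $s>0$ with $B_\sigma(\mu_q(s))$ finite, and let $G=\{q^{*\sigma}>s\}$, $P=\{f>s\}$,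
$m=|G|=\mu_q(s)$, $n=|P|$, $b=|G\setminus P|$. Up to null sets $G$ is a sublevel set of $\sigma$, so
$B_\sigma(m)=\int_G\sigma$. The bathtub inequality for $G\cap P$ and $G\cup P$, of measures $m-b$
and $n+b$, gives $B_\sigma(m-b)+B_\sigma(n+b)-2B_\sigma(m)\le\int_{P\setminus
G}\sigma-\int_{G\setminus P}\sigma$. Passing from $n+b$ to $m+b$ costs at most the integrand of $C$
(`conjExcess_le_of_slopes`), because $f^*$ and $q^*$ have nested level sets and the two $\beta$'s
there are $(m-n)_+$ and $(n-m)_+$. This is `level_inequality`; integrating it in $s$ by the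
layer-cake formula gives (iii).

For (ii), $\|f-q^{*\sigma}\|_1+\|q\|_1-\|f\|_1=2\int b\,ds$, the definition of $H_\sigma$ bounds
$H_\sigma(m)b^2$ by the second difference, and Cauchy–Schwarz in $s$ produces the constant $K$. -/

namespace RefinedHL

/-! ### The rank function $x\mapsto\nu\{\rho<\rho(x)\}$ and its distribution. -/

section Rank

variable {α : Type*} [MeasurableSpace α] {ν : Measure α} {ρ : α → ℝ}

theorem monotone_measure_lt : Monotone fun t : ℝ => ν {x | ρ x < t} :=
  fun _ _ hst => measure_mono fun _ hx => lt_of_lt_of_le hx hst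

theorem measure_lt_le_of_forall {c : ℝ} {m : ℝ≥0∞} (h : ∀ t < c, ν {x | ρ x < t} ≤ m) :
    ν {x | ρ x < c} ≤ m := by
  obtain ⟨u, hu, hlt, hlim⟩ := exists_seq_strictMono_tendsto c
  have hset : {x | ρ x < c} = ⋃ n, {x | ρ x < u n} := by
    ext x
    simp only [mem_ofPred_eq, mem_iUnion]
    exact ⟨fun hx => (hlim.eventually (lt_mem_nhds hx)).exists, fun ⟨n, hn⟩ => hn.trans (hlt n)⟩
  have hmono : Monotone fun n => {x | ρ x < u n} :=
    fun i j hij x (hx : ρ x < u i) => lt_of_lt_of_le hx (hu.monotone hij)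
  rw [hset, hmono.measure_iUnion]
  exact iSup_le fun n => h _ (hlt n)

/-- Continuity from above, hence the finiteness assumption. The limit set is $\{\rho\le c\}$, so
only a null level set identifies right and left limits. -/
theorem le_measure_le_of_forall (hρ : AEMeasurable ρ ν) {c e : ℝ} {m : ℝ≥0∞} (hce : c < e)
    (hfin : ν {x | ρ x < e} ≠ ⊤) (h : ∀ t, c < t → m ≤ ν {x | ρ x < t}) :
    m ≤ ν {x | ρ x ≤ c} := by
  obtain ⟨u, hu, hlt, hlim⟩ := exists_seq_strictAnti_tendsto' hce
  have hset : {x | ρ x ≤ c} = ⋂ n, {x | ρ x < u n} := by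
    ext x
    simp only [mem_ofPred_eq, mem_iInter]
    exact ⟨fun hx n => lt_of_le_of_lt hx (hlt n).1,
      fun hx => ge_of_tendsto' hlim fun n => (hx n).le⟩
  have hanti : Antitone fun n => {x | ρ x < u n} :=
    fun i j hij x (hx : ρ x < u j) => lt_of_lt_of_le hx (hu.antitone hij)
  rw [hset, hanti.measure_iInter (fun n => nullMeasurableSet_lt hρ aemeasurable_const)
    ⟨0, ne_top_of_le_ne_top hfin (monotone_measure_lt (hlt 0).2.le)⟩]
  exact le_iInf fun n => h _ (hlt n).1

theorem exists_measure_lt_lt (hρ : AEMeasurable ρ ν) {m : ℝ≥0∞} (hm : 0 < m) {e : ℝ}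
    (hfin : ν {x | ρ x < e} ≠ ⊤) : ∃ t ≤ e, ν {x | ρ x < t} < m := by
  have hanti : Antitone fun n : ℕ => {x | ρ x < e - n} := by
    intro i j hij x (hx : ρ x < e - j)
    have : (i : ℝ) ≤ j := by exact_mod_cast hij
    show ρ x < e - i
    linarith
  have hset : ⋂ n : ℕ, {x | ρ x < e - n} = ∅ := by
    ext x
    simp only [mem_iInter, mem_ofPred_eq, mem_empty_iff_false, iff_false, not_forall, not_lt]
    obtain ⟨n, hn⟩ := exists_nat_ge (e - ρ x)
    exact ⟨n, by linarith⟩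
  have hlim := tendsto_measure_iInter_atTop (μ := ν)
    (fun n : ℕ => nullMeasurableSet_lt hρ (aemeasurable_const (b := e - (n : ℝ)))) hanti
    ⟨0, by simpa using hfin⟩
  rw [hset, measure_empty] at hlim
  obtain ⟨n, hn⟩ := (hlim.eventually (gt_mem_nhds hm)).exists
  exact ⟨e - n, by simp, hn⟩

/-- If the level sets of `ρ` are null, then `ν {ρ < ·}` takes every intermediate value. -/
theorem exists_measure_lt_eq (hρ : AEMeasurable ρ ν) {m : ℝ≥0∞} (hm : 0 < m) {e : ℝ}
    (hme : m < ν {x | ρ x < e}) (hfin : ν {x | ρ x < e} ≠ ⊤)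
    (hlev : ∀ t < e, ν {x | ρ x = t} = 0) :
    ∃ c < e, ν {x | ρ x < c} = m ∧
      {x | ν {y | ρ y < ρ x} < m} =ᵐ[ν] {x | ρ x < c} := by
  -- An initial ray bounded by $e$; its supremum $c$ is the wanted level.
  set G : Set ℝ := {t | ν {x | ρ x < t} < m} with hG
  obtain ⟨t₀, -, ht₀⟩ := exists_measure_lt_lt hρ hm hfin
  have hne : G.Nonempty := ⟨t₀, ht₀⟩
  have hlt_e : ∀ t ∈ G, t < e := fun t ht => by
    by_contra! h
    exact (hme.trans_le (monotone_measure_lt h)).not_gt ht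
  have hbdd : BddAbove G := ⟨e, fun t ht => (hlt_e t ht).le⟩
  set c := sSup G
  have hmem : ∀ t < c, t ∈ G := fun t ht => by
    obtain ⟨g, hg, htg⟩ := exists_lt_of_lt_csSup hne ht
    exact lt_of_le_of_lt (monotone_measure_lt htg.le) hg
  have hnmem : ∀ t, c < t → m ≤ ν {x | ρ x < t} := fun t ht => by
    by_contra! h
    exact (le_csSup hbdd h).not_gt ht
  have hle : ν {x | ρ x < c} ≤ m := measure_lt_le_of_forall fun t ht => (hmem t ht).le
  have hce : c < e := by
    by_contra! h
    exact (hme.trans_le (monotone_measure_lt h)).not_ge hle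
  have hae : {x | ρ x < c} =ᵐ[ν] {x | ρ x ≤ c} := by
    have : {x | ρ x ≤ c} = {x | ρ x < c} ∪ {x | ρ x = c} := by
      ext x; simp [le_iff_lt_or_eq]
    rw [this]
    exact (union_ae_eq_left_of_ae_eq_empty (ae_eq_empty.2 (hlev c hce))).symm
  have hge : m ≤ ν {x | ρ x < c} := by
    rw [measure_congr hae]
    exact le_measure_le_of_forall hρ hce hfin hnmem
  refine ⟨c, hce, le_antisymm hle hge, ?_⟩
  -- The rank sublevel set lies between $\{\rho<c\}$ and $\{\rho\le c\}$, which differ by a null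
  -- set.
  have h1 : {x | ρ x < c} ⊆ {x | ν {y | ρ y < ρ x} < m} := fun x hx => hmem _ hx
  have h2 : {x | ν {y | ρ y < ρ x} < m} ⊆ {x | ρ x ≤ c} := fun x hx => le_csSup hbdd hx
  have h1' : {x | ρ x < c} ≤ᵐ[ν] {x | ν {y | ρ y < ρ x} < m} := h1.eventuallyLE
  have h2' : {x | ν {y | ρ y < ρ x} < m} ≤ᵐ[ν] {x | ρ x ≤ c} := h2.eventuallyLE
  exact (h2'.trans hae.symm.le).antisymm h1'

/-- Under suitable assumptions `x ↦ ν {ρ < ρ x}` maps `ν` to Lebesgue measure. -/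
theorem measure_rank_lt (hρ : AEMeasurable ρ ν)
    (h : ∀ m < ν univ, ∃ e, m < ν {x | ρ x < e} ∧ ν {x | ρ x < e} ≠ ⊤ ∧
      ∀ t < e, ν {x | ρ x = t} = 0) {m : ℝ≥0∞} (hm : m ≤ ν univ) :
    ν {x | ν {y | ρ y < ρ x} < m} = m := by
  have key : ∀ m < ν univ, ν {x | ν {y | ρ y < ρ x} < m} = m := fun m hm => by
    rcases eq_or_ne m 0 with rfl | hm0
    · simp
    obtain ⟨e, h1, h2, h3⟩ := h m hm
    obtain ⟨c, -, hc, hae⟩ := exists_measure_lt_eq hρ (pos_iff_ne_zero.2 hm0) h1 h2 h3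
    rw [measure_congr hae, hc]
  rcases hm.lt_or_eq with hm | rfl
  · exact key m hm
  -- The total mass, possibly infinite, is reached by exhaustion with smaller values.
  · refine le_antisymm (measure_mono (subset_univ _)) (le_of_forall_lt fun m hm => ?_)
    obtain ⟨m', h1, h2⟩ := exists_between hm
    refine h1.trans_le ?_
    rw [← key m' h2]
    exact measure_mono fun x (hx : _ < m') => hx.trans h2

end Rank

/-! ### Distribution functions and the pseudo-inverse $q^\sharp$. -/

section Sharp

variable {d : ℕ} {Ω : Set (EuclideanSpace ℝ (Fin d))} {q : EuclideanSpace ℝ (Fin d) → ℝ}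

theorem distrib_eq (hΩ : NullMeasurableSet Ω volume) (t : ℝ) :
    distrib Ω q t = volume.restrict Ω {x | t < q x} := by
  rw [Measure.restrict_apply₀' hΩ, distrib]
  congr 1; ext x; simp [and_comm]

theorem jac_eq (hΩ : NullMeasurableSet Ω volume) (t : ℝ) :
    jac Ω q t = volume.restrict Ω {x | q x < t} := by
  rw [Measure.restrict_apply₀' hΩ, jac]
  congr 1; ext x; simp [and_comm]

theorem beta_eq {g : EuclideanSpace ℝ (Fin d) → ℝ} (hΩ : NullMeasurableSet Ω volume) (t : ℝ) :
    beta Ω q g t = volume.restrict Ω {x | q x ≤ t ∧ t < g x} := by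
  rw [Measure.restrict_apply₀' hΩ, beta]
  congr 1; ext x; simp [and_comm, and_assoc]

theorem antitone_distrib : Antitone (distrib Ω q) :=
  fun _ _ hst => measure_mono fun _ hx => ⟨hx.1, lt_of_le_of_lt hst hx.2⟩

theorem monotone_jac : Monotone (jac Ω q) :=
  fun _ _ hst => measure_mono fun _ hx => ⟨hx.1, lt_of_lt_of_le hx.2 hst⟩

theorem jac_le (t : ℝ) : jac Ω q t ≤ volume Ω := measure_mono fun _ hx => hx.1

theorem distrib_le (t : ℝ) : distrib Ω q t ≤ volume Ω := measure_mono fun _ hx => hx.1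

theorem exists_gt_lt_distrib {t : ℝ} {s : ℝ≥0∞} (h : s < distrib Ω q t) :
    ∃ t' > t, s < distrib Ω q t' := by
  obtain ⟨u, hu, hlt, hlim⟩ := exists_seq_strictAnti_tendsto t
  have hset : {x | x ∈ Ω ∧ t < q x} = ⋃ n, {x | x ∈ Ω ∧ u n < q x} := by
    ext x
    simp only [mem_ofPred_eq, mem_iUnion]
    exact ⟨fun hx => ((hlim.eventually (gt_mem_nhds hx.2)).exists).imp fun n hn => ⟨hx.1, hn⟩,
      fun ⟨n, hn⟩ => ⟨hn.1, (hlt n).trans hn.2⟩⟩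
  have hmono : Monotone fun n => {x | x ∈ Ω ∧ u n < q x} :=
    fun i j hij x hx => ⟨hx.1, lt_of_le_of_lt (hu.antitone hij) hx.2⟩
  rw [distrib, hset, hmono.measure_iUnion, lt_iSup_iff] at h
  obtain ⟨n, hn⟩ := h
  exact ⟨u n, hlt n, hn⟩

/-- Right continuity of $\mu_q$ is what makes both inequalities strict: if $s<\mu_q(t)$, this
persists at some $t'>t$, which then bounds the infimum from below. -/
theorem coe_lt_sharp {t : ℝ≥0} {s : ℝ≥0∞} :
    (t : ℝ≥0∞) < sharp Ω q s ↔ s < distrib Ω q t := by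
  constructor
  · intro h
    by_contra! hs
    exact h.not_ge (sInf_le ⟨t, hs, rfl⟩)
  · intro h
    obtain ⟨t', htt', ht'⟩ := exists_gt_lt_distrib h
    lift t' to ℝ≥0 using t.2.trans htt'.le
    refine lt_of_lt_of_le (b := (t' : ℝ≥0∞)) (by exact_mod_cast htt') (le_sInf ?_)
    rintro _ ⟨u, hu, rfl⟩
    have hu : distrib Ω q u ≤ s := hu
    by_contra! hlt
    have : (u : ℝ) ≤ t' := by exact_mod_cast (ENNReal.coe_lt_coe.1 hlt).le
    exact (ht'.trans_le (antitone_distrib this)).not_ge hu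

theorem antitone_sharp : Antitone (sharp Ω q) := fun _ _ hst =>
  sInf_le_sInf (image_mono fun _ (ht : _ ≤ _) => ht.trans hst)

theorem sharp_of_le {s : ℝ≥0∞} (h : volume Ω ≤ s) : sharp Ω q s = 0 := by
  by_contra h0
  have : ((0 : ℝ≥0) : ℝ≥0∞) < sharp Ω q s := by simpa using pos_iff_ne_zero.2 h0
  exact ((coe_lt_sharp.1 this).trans_le (distrib_le _)).not_ge h

theorem distrib_ne_top (hΩ : NullMeasurableSet Ω volume) (hq : NonnegL1 Ω q) {t : ℝ} (ht : 0 < t) :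
    distrib Ω q t ≠ ⊤ := by
  rw [distrib_eq hΩ]
  exact (hq.1.measure_gt_lt_top ht).ne

theorem exists_distrib_le (hΩ : NullMeasurableSet Ω volume) (hq : NonnegL1 Ω q) {s : ℝ≥0∞}
    (hs : 0 < s) : ∃ t : ℝ≥0, distrib Ω q t ≤ s := by
  have hfin := distrib_ne_top hΩ hq one_pos
  rw [distrib_eq hΩ] at hfin
  -- Superlevel sets of $q$ are sublevel sets of $-q$, and $\{q>1\}$ has finite measure.
  obtain ⟨t, -, ht⟩ := exists_measure_lt_lt (ν := volume.restrict Ω) (ρ := fun x => -q x) (e := -1)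
    hq.1.aemeasurable.neg hs (by simpa using hfin)
  refine ⟨(-t).toNNReal, (antitone_distrib (Real.le_coe_toNNReal _)).trans ?_⟩
  rw [distrib_eq hΩ]
  convert ht.le using 4
  exact neg_lt

theorem sharp_ne_top (hΩ : NullMeasurableSet Ω volume) (hq : NonnegL1 Ω q) {s : ℝ≥0∞}
    (hs : 0 < s) : sharp Ω q s ≠ ⊤ := by
  obtain ⟨t, ht⟩ := exists_distrib_le hΩ hq hs
  exact ne_top_of_le_ne_top ENNReal.coe_ne_top (sInf_le ⟨t, ht, rfl⟩)

/-- At $s=0$ the value $q^\sharp(0)$ may be $+\infty$, which `toReal` sends to $0$; positivity of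
$s$ excludes this. -/
theorem lt_toReal_sharp (hΩ : NullMeasurableSet Ω volume) (hq : NonnegL1 Ω q) {s : ℝ≥0∞}
    (hs : 0 < s) {t : ℝ} (ht : 0 ≤ t) : t < (sharp Ω q s).toReal ↔ s < distrib Ω q t := by
  lift t to ℝ≥0 using ht
  rw [← coe_lt_sharp, ← ENNReal.toReal_lt_toReal ENNReal.coe_ne_top (sharp_ne_top hΩ hq hs),
    ENNReal.coe_toReal]

/-- Superlevel sets of a decreasing rearrangement along a rank function. -/
theorem ae_lt_toReal_sharp_iff (hΩ : NullMeasurableSet Ω volume) (hq : NonnegL1 Ω q)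
    {T : EuclideanSpace ℝ (Fin d) → ℝ≥0∞} (hV : volume Ω ≠ 0)
    (hT : ∀ m ≤ volume Ω, volume.restrict Ω {x | T x < m} = m) :
    ∀ᵐ x ∂volume.restrict Ω, ∀ t : ℝ, 0 ≤ t →
      (t < (sharp Ω q (T x)).toReal ↔ T x < distrib Ω q t) := by
  -- The set $\{T=0\}$ lies in $\{T<m'\}$, of measure $m'$, for arbitrarily small $m'>0$.
  have : ∀ᵐ x ∂volume.restrict Ω, 0 < T x := by
    refine ae_iff.2 (le_antisymm (le_of_forall_gt fun m hm => ?_) (zero_le))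
    obtain ⟨m', h1, h2⟩ := exists_between (lt_min hm (pos_iff_ne_zero.2 hV))
    have h3 := hT m' (h2.le.trans (min_le_right _ _))
    refine lt_of_le_of_lt ?_ (h2.trans_le (min_le_left _ _))
    rw [← h3]
    refine measure_mono fun x (hx : ¬ 0 < T x) => ?_
    show T x < m'
    rwa [le_zero_iff.1 (not_lt.1 hx)]
  filter_upwards [this] with x hx t ht
  exact lt_toReal_sharp hΩ hq hx ht

end Sharp

/-! ### Level sets of the two rearrangements. -/

section Admissible

variable {d : ℕ} {Ω : Set (EuclideanSpace ℝ (Fin d))} {σ : EuclideanSpace ℝ (Fin d) → ℝ}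

namespace Admissible

theorem volume_ne_zero (hσ : Admissible Ω σ) : volume Ω ≠ 0 := by
  obtain ⟨e, he⟩ := hσ.nonempty
  exact (lt_of_le_of_lt zero_le he).ne'

theorem bot_lt_eMax (hσ : Admissible Ω σ) : ⊥ < eMax Ω σ := by
  obtain ⟨e, he⟩ := hσ.nonempty
  exact lt_of_lt_of_le (EReal.bot_lt_coe e) (le_sSup ⟨e, he, rfl⟩)

theorem jac_lt (_hσ : Admissible Ω σ) {e : ℝ} (he : (e : EReal) < eMax Ω σ) :
    jac Ω σ e < volume Ω := by
  obtain ⟨_, ⟨t, ht, rfl⟩, het⟩ := lt_sSup_iff.1 he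
  exact (monotone_jac (EReal.coe_lt_coe_iff.1 het).le).trans_lt ht

theorem comap_neBot (hσ : Admissible Ω σ) :
    (comap (fun e : ℝ => (e : EReal)) (𝓝[<] (eMax Ω σ))).NeBot := by
  refine comap_neBot_iff.2 fun t ht => ?_
  obtain ⟨l, hl, hlt⟩ := (mem_nhdsLT_iff_exists_Ioo_subset' hσ.bot_lt_eMax).1 ht
  obtain ⟨e, h1, h2⟩ := EReal.lt_iff_exists_real_btwn.1 hl
  exact ⟨e, hlt ⟨h1, h2⟩⟩

theorem eventually_lt_eMax (_hσ : Admissible Ω σ) :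
    ∀ᶠ e : ℝ in comap (fun e : ℝ => (e : EReal)) (𝓝[<] (eMax Ω σ)), (e : EReal) < eMax Ω σ :=
  tendsto_comap.eventually self_mem_nhdsWithin

theorem exists_lt_jac (hσ : Admissible Ω σ) {m : ℝ≥0∞} (hm : m < volume Ω) :
    ∃ e : ℝ, (e : EReal) < eMax Ω σ ∧ m < jac Ω σ e := by
  have := hσ.comap_neBot
  exact (hσ.eventually_lt_eMax.and (hσ.tendsto_jac.eventually (lt_mem_nhds hm))).exists

theorem exists_lt_eMax (hσ : Admissible Ω σ) : ∃ e : ℝ, (e : EReal) < eMax Ω σ :=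
  (hσ.exists_lt_jac (pos_iff_ne_zero.2 hσ.volume_ne_zero)).imp fun _ h => h.1

theorem jac_of_eMax_le (hσ : Admissible Ω σ) {e : ℝ} (he : eMax Ω σ ≤ e) :
    jac Ω σ e = volume Ω := by
  refine le_antisymm (jac_le e) (le_of_forall_lt fun m hm => ?_)
  obtain ⟨t, ht, hmt⟩ := hσ.exists_lt_jac hm
  exact hmt.trans_le (monotone_jac (EReal.coe_le_coe_iff.1 (ht.le.trans he)))

theorem level_null' (hσ : Admissible Ω σ) {e : ℝ} (he : (e : EReal) < eMax Ω σ) :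
    volume.restrict Ω {x | σ x = e} = 0 := by
  rw [Measure.restrict_apply₀' hσ.measurable_domain, ← hσ.level_null e he]
  congr 1; ext x; simp [and_comm]

theorem rank_aux (hσ : Admissible Ω σ) {m : ℝ≥0∞} (hm : m < volume Ω) :
    ∃ e : ℝ, (e : EReal) < eMax Ω σ ∧ m < volume.restrict Ω {x | σ x < e} ∧
      volume.restrict Ω {x | σ x < e} ≠ ⊤ ∧ ∀ t < e, volume.restrict Ω {x | σ x = t} = 0 := by
  obtain ⟨e, he, hme⟩ := hσ.exists_lt_jac hm
  refine ⟨e, he, ?_, ?_, fun t ht => hσ.level_null' ((EReal.coe_lt_coe_iff.2 ht).trans he)⟩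
  · rwa [← jac_eq hσ.measurable_domain]
  · rw [← jac_eq hσ.measurable_domain]
    exact (hσ.jac_lt he).ne_top

theorem measure_jac_lt (hσ : Admissible Ω σ) {m : ℝ≥0∞} (hm : m ≤ volume Ω) :
    volume.restrict Ω {x | jac Ω σ (σ x) < m} = m := by
  simp_rw [jac_eq hσ.measurable_domain]
  refine measure_rank_lt hσ.measurable_fun (fun m hm => ?_) (by simpa using hm)
  obtain ⟨e, -, h⟩ := hσ.rank_aux (m := m) (by simpa using hm)
  exact ⟨e, h⟩

theorem exists_jac_eq (hσ : Admissible Ω σ) {m : ℝ≥0∞} (hm0 : 0 < m) (hm : m < volume Ω) :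
    ∃ c : ℝ, (c : EReal) < eMax Ω σ ∧ jac Ω σ c = m ∧
      {x | jac Ω σ (σ x) < m} =ᵐ[volume.restrict Ω] {x | σ x < c} := by
  obtain ⟨e, he, h1, h2, h3⟩ := hσ.rank_aux hm
  obtain ⟨c, hce, h4, h5⟩ := exists_measure_lt_eq hσ.measurable_fun hm0 h1 h2 h3
  simp_rw [jac_eq hσ.measurable_domain]
  exact ⟨c, (EReal.coe_lt_coe_iff.2 hce).trans he, h4, h5⟩

theorem aemeasurable_rank (hσ : Admissible Ω σ) :
    AEMeasurable (fun x => jac Ω σ (σ x)) (volume.restrict Ω) :=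
  monotone_jac.measurable.comp_aemeasurable hσ.measurable_fun

/-- The cutoff is redundant: where $\sigma\ge e_{\max}$ the rank is $|\Omega|$, and
$q^\sharp(|\Omega|)=0$. -/
theorem sigmaRearr_eq (hσ : Admissible Ω σ) (q : EuclideanSpace ℝ (Fin d) → ℝ) :
    sigmaRearr Ω σ q = fun x => (sharp Ω q (jac Ω σ (σ x))).toReal := by
  ext x
  rw [sigmaRearr]
  split_ifs with h
  · rfl
  · rw [hσ.jac_of_eMax_le (not_lt.1 h), sharp_of_le le_rfl, ENNReal.toReal_zero]

theorem sigmaRearr_nonneg (hσ : Admissible Ω σ) (q x) : 0 ≤ sigmaRearr Ω σ q x := by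
  rw [hσ.sigmaRearr_eq]; exact ENNReal.toReal_nonneg

theorem aemeasurable_sigmaRearr (hσ : Admissible Ω σ) (q : EuclideanSpace ℝ (Fin d) → ℝ) :
    AEMeasurable (sigmaRearr Ω σ q) (volume.restrict Ω) := by
  rw [hσ.sigmaRearr_eq]
  exact (antitone_sharp.measurable.comp_aemeasurable hσ.aemeasurable_rank).ennreal_toReal

theorem ae_lt_sigmaRearr_iff (hσ : Admissible Ω σ) {q : EuclideanSpace ℝ (Fin d) → ℝ}
    (hq : NonnegL1 Ω q) : ∀ᵐ x ∂volume.restrict Ω, ∀ t : ℝ, 0 ≤ t →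
      (t < sigmaRearr Ω σ q x ↔ jac Ω σ (σ x) < distrib Ω q t) := by
  rw [hσ.sigmaRearr_eq]
  exact ae_lt_toReal_sharp_iff hσ.measurable_domain hq hσ.volume_ne_zero
    fun m hm => hσ.measure_jac_lt hm

theorem measure_lt_sigmaRearr (hσ : Admissible Ω σ) {q : EuclideanSpace ℝ (Fin d) → ℝ}
    (hq : NonnegL1 Ω q) {t : ℝ} (ht : 0 ≤ t) :
    volume.restrict Ω {x | t < sigmaRearr Ω σ q x} = distrib Ω q t := by
  rw [← hσ.measure_jac_lt (distrib_le (q := q) t)]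
  refine measure_congr ?_
  filter_upwards [hσ.ae_lt_sigmaRearr_iff hq] with x hx
  exact propext (hx t ht)

end Admissible

/-- The norm is an admissible rank because spheres are null (this needs $d\ge1$) and balls have
finite measure and exhaust the space. -/
theorem measure_norm_rank_lt (hd : 1 ≤ d) (hΩ : NullMeasurableSet Ω volume) {m : ℝ≥0∞}
    (hm : m ≤ volume Ω) :
    volume.restrict Ω
      {x | volume (Metric.ball (0 : EuclideanSpace ℝ (Fin d)) ‖x‖ ∩ Ω) < m} = m := by
  have : Nonempty (Fin d) := ⟨⟨0, hd⟩⟩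
  have hball : ∀ r : ℝ, {y : EuclideanSpace ℝ (Fin d) | ‖y‖ < r} = Metric.ball 0 r := fun r => by
    ext; simp
  simp_rw [← Measure.restrict_apply₀' hΩ, ← hball]
  refine measure_rank_lt continuous_norm.measurable.aemeasurable (fun m hm => ?_) (by simpa using hm)
  have hset : (univ : Set (EuclideanSpace ℝ (Fin d))) = ⋃ n : ℕ, {y | ‖y‖ < n} := by
    ext y
    simpa using exists_nat_gt ‖y‖
  have hmono : Monotone fun n : ℕ => {y : EuclideanSpace ℝ (Fin d) | ‖y‖ < n} :=
    fun i j hij y (hy : ‖y‖ < i) => hy.trans_le (by exact_mod_cast hij)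
  rw [hset, hmono.measure_iUnion, lt_iSup_iff] at hm
  obtain ⟨n, hn⟩ := hm
  refine ⟨n, hn, ?_, fun t _ => ?_⟩
  · rw [hball]
    exact ((Measure.restrict_apply_le _ _).trans_lt measure_ball_lt_top).ne
  · refine le_antisymm ((Measure.restrict_apply_le _ _).trans ?_) zero_le
    have : {x : EuclideanSpace ℝ (Fin d) | ‖x‖ = t} = Metric.sphere 0 t := by ext; simp
    rw [this, Measure.addHaar_sphere]

/-- Both rearrangements decrease along the same rank, so their superlevel sets are nested up to null
sets and truncated subtraction gives the measure of the difference. -/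
theorem beta_rearr (hd : 1 ≤ d) (hΩ : NullMeasurableSet Ω volume) (hV : volume Ω ≠ 0)
    {f g : EuclideanSpace ℝ (Fin d) → ℝ} (hf : NonnegL1 Ω f) (hg : NonnegL1 Ω g) {s : ℝ}
    (hs : 0 < s) :
    beta Ω (rearr Ω f) (rearr Ω g) s = distrib Ω g s - distrib Ω f s := by
  set T : EuclideanSpace ℝ (Fin d) → ℝ≥0∞ :=
    fun x => volume (Metric.ball (0 : EuclideanSpace ℝ (Fin d)) ‖x‖ ∩ Ω)
  have hT : ∀ m ≤ volume Ω, volume.restrict Ω {x | T x < m} = m :=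
    fun m hm => measure_norm_rank_lt hd hΩ hm
  have hmeas : Measurable T := by
    have : Monotone fun r : ℝ => volume (Metric.ball (0 : EuclideanSpace ℝ (Fin d)) r ∩ Ω) :=
      fun r r' h => measure_mono (inter_subset_inter_left _ (Metric.ball_subset_ball h))
    exact this.measurable.comp measurable_norm
  have hset : {x | rearr Ω f x ≤ s ∧ s < rearr Ω g x} =ᵐ[volume.restrict Ω]
      ({x | T x < distrib Ω g s} \ {x | T x < distrib Ω f s} : Set _) := by
    filter_upwards [ae_lt_toReal_sharp_iff hΩ hf hV hT, ae_lt_toReal_sharp_iff hΩ hg hV hT]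
      with x h1 h2
    refine propext ((and_comm.trans ?_ : _ ↔ (_ ∧ ¬ _)))
    exact and_congr (h2 s hs.le) (not_lt.symm.trans (not_congr (h1 s hs.le)))
  rw [beta_eq hΩ, measure_congr hset]
  rcases le_total (distrib Ω f s) (distrib Ω g s) with h | h
  · have hsub : {x | T x < distrib Ω f s} ⊆ {x | T x < distrib Ω g s} :=
      fun x hx => lt_of_lt_of_le hx h
    rw [measure_sdiff hsub (measurableSet_lt hmeas measurable_const).nullMeasurableSet,
      hT _ (distrib_le _), hT _ (distrib_le _)]
    rw [hT _ (distrib_le _)]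
    exact distrib_ne_top hΩ hf hs
  · have hsub : {x | T x < distrib Ω g s} ⊆ {x | T x < distrib Ω f s} :=
      fun x hx => lt_of_lt_of_le hx h
    rw [tsub_eq_zero_of_le h, sdiff_eq_empty.2 hsub, measure_empty]

end Admissible

/-! ### Duality between $B_\sigma$ and $e\mapsto\int_\Omega(e-\sigma)_+$. -/

section Excess

variable {d : ℕ} {Ω : Set (EuclideanSpace ℝ (Fin d))} {σ : EuclideanSpace ℝ (Fin d) → ℝ}

/-- The integral `∫_Ω (e - σ)₊`. -/
noncomputable def excess (Ω : Set (EuclideanSpace ℝ (Fin d))) (σ : EuclideanSpace ℝ (Fin d) → ℝ)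
    (e : ℝ) : ℝ :=
  ∫ x in Ω, max (e - σ x) 0

/-- The Legendre transform of `excess` on `(-∞, e_max)`. -/
noncomputable def conjExcess (Ω : Set (EuclideanSpace ℝ (Fin d)))
    (σ : EuclideanSpace ℝ (Fin d) → ℝ) (x : ℝ) : EReal :=
  ⨆ e : {e : ℝ // (e : EReal) < eMax Ω σ}, ((e * x - excess Ω σ e : ℝ) : EReal)

theorem le_conjExcess {e : ℝ} (he : (e : EReal) < eMax Ω σ) (x : ℝ) :
    ((e * x - excess Ω σ e : ℝ) : EReal) ≤ conjExcess Ω σ x :=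
  le_iSup (fun e : {e : ℝ // (e : EReal) < eMax Ω σ} => ((e * x - excess Ω σ e : ℝ) : EReal))
    ⟨e, he⟩

theorem conjExcess_le {x : ℝ} {c : EReal}
    (h : ∀ e : ℝ, (e : EReal) < eMax Ω σ → ((e * x - excess Ω σ e : ℝ) : EReal) ≤ c) :
    conjExcess Ω σ x ≤ c :=
  iSup_le fun e => h e e.2

theorem measurable_conjExcess : Measurable (conjExcess Ω σ) := by
  refine LowerSemicontinuous.measurable (lowerSemicontinuous_iSup fun e => ?_)
  refine Continuous.lowerSemicontinuous ?_
  exact continuous_coe_real_ereal.comp (by fun_prop)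

namespace Admissible

theorem bot_lt_conjExcess (hσ : Admissible Ω σ) (x : ℝ) : ⊥ < conjExcess Ω σ x := by
  obtain ⟨e, he⟩ := hσ.exists_lt_eMax
  exact (EReal.bot_lt_coe _).trans_le (le_conjExcess he x)

theorem nullMeasurableSet_rank_lt (hσ : Admissible Ω σ) (m : ℝ≥0∞) :
    NullMeasurableSet {x | jac Ω σ (σ x) < m} (volume.restrict Ω) :=
  nullMeasurableSet_lt hσ.aemeasurable_rank aemeasurable_const

theorem restrict_sublevel (hσ : Admissible Ω σ) (m : ℝ≥0∞) :
    volume.restrict (sublevel Ω σ m) =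
      (volume.restrict Ω).restrict {x | jac Ω σ (σ x) < m} := by
  rw [Measure.restrict_restrict₀ (hσ.nullMeasurableSet_rank_lt m)]
  congr 1; ext x; simp [sublevel, and_comm]

theorem integrableOn_rank_lt (hσ : Admissible Ω σ)
    (hB : ∀ μ : ℝ≥0∞, μ < volume Ω → IntegrableOn σ (sublevel Ω σ μ) volume) {m : ℝ≥0∞}
    (hm : m < volume Ω) : IntegrableOn σ {x | jac Ω σ (σ x) < m} (volume.restrict Ω) := by
  have := hB m hm
  rwa [IntegrableOn, hσ.restrict_sublevel] at this

/-- The integrand lives on $\{\sigma<e\}$, contained in a rank sublevel set $\{a_\sigma(\sigma)<m\}$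
with $a_\sigma(e)<m<|\Omega|$, which has finite measure and carries an integrable $\sigma$. -/
theorem integrable_excess (hσ : Admissible Ω σ)
    (hB : ∀ μ : ℝ≥0∞, μ < volume Ω → IntegrableOn σ (sublevel Ω σ μ) volume) {e : ℝ}
    (he : (e : EReal) < eMax Ω σ) :
    Integrable (fun x => max (e - σ x) 0) (volume.restrict Ω) := by
  obtain ⟨m, hm1, hm2⟩ := exists_between (hσ.jac_lt he)
  set A := {x | jac Ω σ (σ x) < m}
  have hA : IntegrableOn (fun x => e - σ x) A (volume.restrict Ω) := by
    refine Integrable.sub (integrableOn_const ?_) (hσ.integrableOn_rank_lt hB hm2)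
    rw [hσ.measure_jac_lt hm2.le]
    exact hm2.ne_top
  refine (hA.integrable_indicator₀ (hσ.nullMeasurableSet_rank_lt m)).norm.mono'
    ?_ (Eventually.of_forall fun x => ?_)
  · exact ((aemeasurable_const.sub hσ.measurable_fun).max aemeasurable_const).aestronglyMeasurable
  · rw [Real.norm_of_nonneg (le_max_right _ _)]
    by_cases hx : σ x < e
    · have hxA : x ∈ A := lt_of_le_of_lt (monotone_jac hx.le) hm1
      rw [indicator_of_mem hxA, max_eq_left (by linarith)]
      exact Real.le_norm_self _
    · rw [max_eq_right (by linarith)]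
      exact norm_nonneg _

theorem nullMeasurableSet_lt_const (hσ : Admissible Ω σ) (e : ℝ) :
    NullMeasurableSet {x | σ x < e} (volume.restrict Ω) :=
  nullMeasurableSet_lt hσ.measurable_fun aemeasurable_const

theorem integral_indicator_const (hσ : Admissible Ω σ) (e c : ℝ) :
    ∫ x in Ω, ({x | σ x < e} : Set _).indicator (fun _ => c) x = c * (jac Ω σ e).toReal := by
  rw [integral_indicator₀ (hσ.nullMeasurableSet_lt_const e), setIntegral_const,
    jac_eq hσ.measurable_domain, smul_eq_mul, mul_comm]
  rfl

theorem integrable_indicator_const (hσ : Admissible Ω σ) {e : ℝ} (he : (e : EReal) < eMax Ω σ)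
    (c : ℝ) :
    Integrable (({x | σ x < e} : Set _).indicator fun _ => c) (volume.restrict Ω) := by
  refine IntegrableOn.integrable_indicator₀ (integrableOn_const ?_)
    (hσ.nullMeasurableSet_lt_const e)
  rw [← jac_eq hσ.measurable_domain]
  exact (hσ.jac_lt he).ne_top

/-- Pointwise, $(e'-\sigma)_+-(e-\sigma)_+\le(e'-e)1_{\sigma<e'}$. With the companion lower bound,
difference quotients of `excess` on $[e,e']$ lie between $a_\sigma(e)$ and $a_\sigma(e')$. -/
theorem excess_sub_le (hσ : Admissible Ω σ)
    (hB : ∀ μ : ℝ≥0∞, μ < volume Ω → IntegrableOn σ (sublevel Ω σ μ) volume) {e e' : ℝ}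
    (hee : e ≤ e') (he : (e' : EReal) < eMax Ω σ) :
    excess Ω σ e' - excess Ω σ e ≤ (e' - e) * (jac Ω σ e').toReal := by
  have he' : (e : EReal) < eMax Ω σ := lt_of_le_of_lt (EReal.coe_le_coe_iff.2 hee) he
  rw [excess, excess, ← integral_sub (hσ.integrable_excess hB he) (hσ.integrable_excess hB he'),
    ← hσ.integral_indicator_const]
  refine integral_mono ((hσ.integrable_excess hB he).sub (hσ.integrable_excess hB he'))
    (hσ.integrable_indicator_const he _) fun x => ?_
  by_cases hx : σ x < e'
  · have hx' : x ∈ {x | σ x < e'} := hx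
    simp only [indicator_of_mem hx']
    rw [max_eq_left (by linarith : 0 ≤ e' - σ x)]
    linarith [le_max_left (e - σ x) 0]
  · have hx' : x ∉ {x | σ x < e'} := hx
    simp only [indicator_of_notMem hx']
    rw [max_eq_right (by linarith : e' - σ x ≤ 0)]
    linarith [le_max_right (e - σ x) 0]

theorem le_excess_sub (hσ : Admissible Ω σ)
    (hB : ∀ μ : ℝ≥0∞, μ < volume Ω → IntegrableOn σ (sublevel Ω σ μ) volume) {e e' : ℝ}
    (hee : e ≤ e') (he : (e' : EReal) < eMax Ω σ) :
    (e' - e) * (jac Ω σ e).toReal ≤ excess Ω σ e' - excess Ω σ e := by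
  have he' : (e : EReal) < eMax Ω σ := lt_of_le_of_lt (EReal.coe_le_coe_iff.2 hee) he
  rw [excess, excess, ← integral_sub (hσ.integrable_excess hB he) (hσ.integrable_excess hB he'),
    ← hσ.integral_indicator_const]
  refine integral_mono (hσ.integrable_indicator_const he' _)
    ((hσ.integrable_excess hB he).sub (hσ.integrable_excess hB he')) fun x => ?_
  by_cases hx : σ x < e
  · have hx' : x ∈ {x | σ x < e} := hx
    simp only [indicator_of_mem hx']
    rw [max_eq_left (by linarith : 0 ≤ e - σ x)]
    linarith [le_max_left (e' - σ x) 0]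
  · have hx' : x ∉ {x | σ x < e} := hx
    simp only [indicator_of_notMem hx']
    rw [max_eq_right (by linarith : e - σ x ≤ 0)]
    linarith [le_max_right (e' - σ x) 0]

/-- The bathtub inequality: integrate $e-\sigma\le(e-\sigma)_+$ over $A$, then enlarge $A$ to
$\Omega$. -/
theorem le_setIntegral (hσ : Admissible Ω σ)
    (hB : ∀ μ : ℝ≥0∞, μ < volume Ω → IntegrableOn σ (sublevel Ω σ μ) volume)
    {A : Set (EuclideanSpace ℝ (Fin d))} (hA : volume.restrict Ω A ≠ ⊤)
    (hi : IntegrableOn σ A (volume.restrict Ω)) {e : ℝ} (he : (e : EReal) < eMax Ω σ) :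
    e * (volume.restrict Ω A).toReal - excess Ω σ e ≤ ∫ x in A, σ x ∂volume.restrict Ω := by
  have hc : IntegrableOn (fun _ => e) A (volume.restrict Ω) := integrableOn_const hA
  have h1 : ∫ x in A, (e - σ x) ∂volume.restrict Ω ≤ excess Ω σ e :=
    (integral_mono (hc.sub hi) (hσ.integrable_excess hB he).integrableOn
      fun x => le_max_left _ _).trans
      (setIntegral_le_integral (hσ.integrable_excess hB he)
        (Eventually.of_forall fun x => le_max_right _ _))
  rw [integral_sub hc hi, setIntegral_const, smul_eq_mul, mul_comm] at h1
  have : (volume.restrict Ω).real A = (volume.restrict Ω A).toReal := rfl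
  rw [this] at h1
  linarith

theorem conjExcess_le_setIntegral (hσ : Admissible Ω σ)
    (hB : ∀ μ : ℝ≥0∞, μ < volume Ω → IntegrableOn σ (sublevel Ω σ μ) volume)
    {A : Set (EuclideanSpace ℝ (Fin d))} (hA : volume.restrict Ω A ≠ ⊤)
    (hi : IntegrableOn σ A (volume.restrict Ω)) :
    conjExcess Ω σ (volume.restrict Ω A).toReal ≤
      ((∫ x in A, σ x ∂volume.restrict Ω : ℝ) : EReal) :=
  conjExcess_le fun _ he => EReal.coe_le_coe_iff.2 (hσ.le_setIntegral hB hA hi he)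

theorem lintegral_neg_ne_top (hσ : Admissible Ω σ)
    (hB : ∀ μ : ℝ≥0∞, μ < volume Ω → IntegrableOn σ (sublevel Ω σ μ) volume)
    {A : Set (EuclideanSpace ℝ (Fin d))} (hA : volume.restrict Ω A ≠ ⊤) :
    ∫⁻ x in A, ENNReal.ofReal (-σ x) ∂volume.restrict Ω ≠ ⊤ := by
  obtain ⟨e, he⟩ := hσ.exists_lt_eMax
  have hi : IntegrableOn (fun x => max (e - σ x) 0 + |e|) A (volume.restrict Ω) :=
    (hσ.integrable_excess hB he).integrableOn.add (integrableOn_const hA)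
  refine ne_top_of_le_ne_top hi.lintegral_lt_top.ne (lintegral_mono fun x => ?_)
  refine ENNReal.ofReal_le_ofReal ?_
  linarith [le_max_left (e - σ x) 0, neg_le_abs e]

theorem setIntegral_lt_eq (hσ : Admissible Ω σ)
    (hB : ∀ μ : ℝ≥0∞, μ < volume Ω → IntegrableOn σ (sublevel Ω σ μ) volume) {c : ℝ}
    (hc : (c : EReal) < eMax Ω σ) :
    ∫ x in {x | σ x < c}, σ x ∂volume.restrict Ω = c * (jac Ω σ c).toReal - excess Ω σ c := by
  have h1 : excess Ω σ c = ∫ x in {x | σ x < c}, max (c - σ x) 0 ∂volume.restrict Ω := by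
    refine (setIntegral_eq_integral_of_forall_compl_eq_zero fun x hx => ?_).symm
    have hx : ¬ σ x < c := hx
    exact max_eq_right (by linarith)
  have hconst : IntegrableOn (fun _ => c) {x | σ x < c} (volume.restrict Ω) := by
    refine integrableOn_const ?_
    rw [← jac_eq hσ.measurable_domain]
    exact (hσ.jac_lt hc).ne_top
  rw [h1, ← hσ.integral_indicator_const, integral_indicator₀ (hσ.nullMeasurableSet_lt_const c),
    ← integral_sub hconst (hσ.integrable_excess hB hc).integrableOn]
  refine setIntegral_congr_fun₀ (hσ.nullMeasurableSet_lt_const c) fun x (hx : σ x < c) => ?_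
  rw [max_eq_left (by linarith)]
  ring

theorem exists_excess_lt (hσ : Admissible Ω σ)
    (hB : ∀ μ : ℝ≥0∞, μ < volume Ω → IntegrableOn σ (sublevel Ω σ μ) volume) {ε : ℝ}
    (hε : 0 < ε) : ∃ e : ℝ, (e : EReal) < eMax Ω σ ∧ excess Ω σ e < ε := by
  obtain ⟨e, he⟩ := hσ.exists_lt_eMax
  have hle : ∀ n : ℕ, e - n ≤ e := fun n => by simp
  have hlim : Tendsto (fun n : ℕ => excess Ω σ (e - n)) atTop (𝓝 (∫ _ in Ω, (0 : ℝ))) := by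
    refine tendsto_integral_of_dominated_convergence (fun x => max (e - σ x) 0)
      (fun n => ?_) (hσ.integrable_excess hB he) (fun n => Eventually.of_forall fun x => ?_)
      (Eventually.of_forall fun x => ?_)
    · exact ((aemeasurable_const.sub hσ.measurable_fun).max
        aemeasurable_const).aestronglyMeasurable
    · rw [Real.norm_of_nonneg (le_max_right _ _)]
      exact max_le_max_right _ (by linarith [hle n])
    · refine tendsto_const_nhds.congr' ?_
      obtain ⟨N, hN⟩ := exists_nat_ge (e - σ x)
      filter_upwards [eventually_ge_atTop N] with n hn
      have : (N : ℝ) ≤ n := by exact_mod_cast hn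
      exact (max_eq_right (by linarith)).symm
  rw [integral_zero] at hlim
  obtain ⟨n, hn⟩ := (hlim.eventually (gt_mem_nhds hε)).exists
  exact ⟨e - n, lt_of_le_of_lt (EReal.coe_le_coe_iff.2 (hle n)) he, hn⟩

theorem bigB_eq (hσ : Admissible Ω σ) (m : ℝ≥0∞) :
    bigB Ω σ m = ∫ x in {x | jac Ω σ (σ x) < m}, σ x ∂volume.restrict Ω := by
  rw [bigB, hσ.restrict_sublevel]

/-- For $m>0$ the supremum is attained at a level $c$ with $a_\sigma(c)=m$, the equality case of the
bathtub inequality. For $m=0$ it is only approached as $e\to-\infty$, where `excess` tends to $0$.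
-/
theorem coe_bigB (hσ : Admissible Ω σ)
    (hB : ∀ μ : ℝ≥0∞, μ < volume Ω → IntegrableOn σ (sublevel Ω σ μ) volume) {m : ℝ≥0∞}
    (hm : m < volume Ω) : (bigB Ω σ m : EReal) = conjExcess Ω σ m.toReal := by
  have hmeas := hσ.measure_jac_lt hm.le
  apply le_antisymm
  · rcases eq_or_ne m 0 with rfl | hm0
    · rw [hσ.bigB_eq]
      simp only [not_lt_zero, ENNReal.toReal_zero]
      rw [show ({x : EuclideanSpace ℝ (Fin d) | False} : Set _) = ∅ from rfl, setIntegral_empty]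
      refine EReal.ge_of_forall_gt_iff_ge.1 fun z hz => ?_
      obtain ⟨e, he, hez⟩ := hσ.exists_excess_lt hB (ε := -z) (by
        have : z < 0 := by exact_mod_cast hz
        linarith)
      exact le_trans (EReal.coe_le_coe_iff.2 (by linarith)) (le_conjExcess he 0)
    · obtain ⟨c, hc, hcm, hae⟩ := hσ.exists_jac_eq (pos_iff_ne_zero.2 hm0) hm
      rw [hσ.bigB_eq, setIntegral_congr_set hae, hσ.setIntegral_lt_eq hB hc, hcm]
      exact le_conjExcess hc _
  · have := hσ.conjExcess_le_setIntegral hB (A := {x | jac Ω σ (σ x) < m})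
      (by rw [hmeas]; exact hm.ne_top) (hσ.integrableOn_rank_lt hB hm)
    rwa [hmeas, ← hσ.bigB_eq] at this

end Admissible

end Excess

theorem extIntegral_of_integrable {α : Type*} [MeasurableSpace α] {ν : Measure α} {g : α → ℝ}
    (hg : Integrable g ν) : extIntegral ν (fun x => (g x : EReal)) = ((∫ x, g x ∂ν : ℝ) : EReal) := by
  have h1 : ∫⁻ x, ENNReal.ofReal (g x) ∂ν ≠ ⊤ := hg.lintegral_lt_top.ne
  have h2 : ∫⁻ x, ENNReal.ofReal (-g x) ∂ν ≠ ⊤ := hg.neg.lintegral_lt_top.ne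
  rw [extIntegral, integral_eq_lintegral_pos_part_sub_lintegral_neg_part hg, EReal.coe_sub,
    EReal.coe_ennreal_toReal h1, EReal.coe_ennreal_toReal h2]
  rfl

theorem integrable_of_lintegral_ofReal {α : Type*} [MeasurableSpace α] {ν : Measure α} {g : α → ℝ}
    (hg : AEMeasurable g ν) (hpos : ∫⁻ x, ENNReal.ofReal (g x) ∂ν ≠ ⊤)
    (hneg : ∫⁻ x, ENNReal.ofReal (-g x) ∂ν ≠ ⊤) : Integrable g ν := by
  refine ⟨hg.aestronglyMeasurable, ?_⟩
  refine lt_of_le_of_lt (lintegral_mono fun x => ?_)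
    ((lintegral_add_left' hg.ennreal_ofReal fun x => ENNReal.ofReal (-g x)).trans_lt
      (ENNReal.add_lt_top.2 ⟨hpos.lt_top, hneg.lt_top⟩))
  rw [Real.enorm_eq_ofReal_abs]
  rcases abs_cases (g x) with h | h <;> rw [h.1]
  · exact le_self_add
  · exact le_add_self

theorem extIntegral_eq_top {α : Type*} [MeasurableSpace α] {ν : Measure α} {g : α → ℝ}
    (hg : AEMeasurable g ν) (hneg : ∫⁻ x, ENNReal.ofReal (-g x) ∂ν ≠ ⊤) (hni : ¬ Integrable g ν) :
    extIntegral ν (fun x => (g x : EReal)) = ⊤ := by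
  have hpos : ∫⁻ x, ENNReal.ofReal (g x) ∂ν = ⊤ := by
    by_contra h
    exact hni (integrable_of_lintegral_ofReal hg h hneg)
  have h1 : ∫⁻ x, (g x : EReal).toENNReal ∂ν = ⊤ := hpos
  have h2 : ∫⁻ x, (-(g x : EReal)).toENNReal ∂ν ≠ ⊤ := hneg
  rw [extIntegral, h1, EReal.coe_ennreal_top, ← EReal.coe_ennreal_toReal h2]
  exact EReal.top_sub_coe _

/-! ### The extension of $B_\sigma$ beyond $|\Omega|$ as the same Legendre transform. -/

section Extension

variable {d : ℕ} {Ω : Set (EuclideanSpace ℝ (Fin d))} {σ : EuclideanSpace ℝ (Fin d) → ℝ}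

namespace Admissible

theorem ae_lt_eMax (hσ : Admissible Ω σ) (hV : volume Ω ≠ ⊤) :
    ∀ᵐ x ∂volume.restrict Ω, (σ x : EReal) < eMax Ω σ := by
  have : ∀ᵐ x ∂volume.restrict Ω, jac Ω σ (σ x) < volume Ω := by
    have h := measure_compl₀ (hσ.nullMeasurableSet_rank_lt (volume Ω))
      (by rw [hσ.measure_jac_lt le_rfl]; exact hV)
    rw [hσ.measure_jac_lt le_rfl, Measure.restrict_apply_univ, tsub_self] at h
    exact h
  filter_upwards [this] with x hx
  by_contra! h
  exact hx.ne (hσ.jac_of_eMax_le h)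

/-- The bounded quantity is $\int_\Omega\min(e,\sigma)$. As $e\to e_{\max}$ the truncations increase
to $\sigma$ almost everywhere, so Fatou's lemma yields both integrability and the bound. -/
theorem integral_le_of_bound (hσ : Admissible Ω σ)
    (hB : ∀ μ : ℝ≥0∞, μ < volume Ω → IntegrableOn σ (sublevel Ω σ μ) volume)
    (hV : volume Ω ≠ ⊤) {e₀ M : ℝ} (he₀ : (e₀ : EReal) < eMax Ω σ)
    (hM : ∀ e : ℝ, e₀ ≤ e → (e : EReal) < eMax Ω σ →
      e * (volume Ω).toReal - excess Ω σ e ≤ M) :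
    Integrable σ (volume.restrict Ω) ∧ ∫ x in Ω, σ x ≤ M := by
  have : IsFiniteMeasure (volume.restrict Ω) := ⟨by simpa using hV.lt_top⟩
  set h : ℝ → EuclideanSpace ℝ (Fin d) → ℝ := fun e x => e - max (e - σ x) 0 with hh
  have hint : ∀ e : ℝ, (e : EReal) < eMax Ω σ → Integrable (h e) (volume.restrict Ω) :=
    fun e he => (integrable_const e).sub (hσ.integrable_excess hB he)
  have hval : ∀ e : ℝ, (e : EReal) < eMax Ω σ →
      ∫ x in Ω, h e x = e * (volume Ω).toReal - excess Ω σ e := fun e he => by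
    rw [integral_sub (integrable_const e) (hσ.integrable_excess hB he), setIntegral_const,
      smul_eq_mul, mul_comm]
    rfl
  have hle : ∀ e x, h e x ≤ σ x := fun e x => by
    simp only [hh]; linarith [le_max_left (e - σ x) 0]
  have hmono : ∀ e e' x, e ≤ e' → h e x ≤ h e' x := fun e e' x hee => by
    simp only [hh]
    rcases max_cases (e' - σ x) 0 with h1 | h1 <;>
      linarith [le_max_left (e - σ x) 0, le_max_right (e - σ x) 0]
  set c₀ := e₀ * (volume Ω).toReal - excess Ω σ e₀
  have hc₀ : c₀ ≤ M := hM e₀ le_rfl he₀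
  have := hσ.comap_neBot
  obtain ⟨u, hu⟩ := exists_seq_tendsto
    (comap (fun e : ℝ => (e : EReal)) (𝓝[<] (eMax Ω σ)))
  have hu' : Tendsto (fun n => (u n : EReal)) atTop (𝓝[<] (eMax Ω σ)) :=
    (tendsto_comap (f := fun e : ℝ => (e : EReal))).comp hu
  have hu1 : ∀ᶠ n in atTop, (u n : EReal) < eMax Ω σ := hu'.eventually self_mem_nhdsWithin
  have hu2 : ∀ y : ℝ, (y : EReal) < eMax Ω σ → ∀ᶠ n in atTop, y < u n := fun y hy => by
    have := (tendsto_nhds_of_tendsto_nhdsWithin hu').eventually (lt_mem_nhds hy)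
    simpa using this
  have hσ0 : AEMeasurable (fun x => σ x - h e₀ x) (volume.restrict Ω) :=
    hσ.measurable_fun.sub (hint e₀ he₀).aemeasurable
  -- Subtracting the truncation at $e_0$ makes the functions nonnegative, as Fatou requires.
  have hlim : ∫⁻ x in Ω, ENNReal.ofReal (σ x - h e₀ x) ≤ ENNReal.ofReal (M - c₀) := by
    calc ∫⁻ x in Ω, ENNReal.ofReal (σ x - h e₀ x)
        ≤ ∫⁻ x in Ω, liminf (fun n => ENNReal.ofReal (h (u n) x - h e₀ x)) atTop := by
          refine lintegral_mono_ae ?_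
          filter_upwards [hσ.ae_lt_eMax hV] with x hx
          refine le_liminf_of_le (by isBoundedDefault) ?_
          filter_upwards [hu2 _ hx] with n hn
          refine ENNReal.ofReal_le_ofReal ?_
          have : h (u n) x = σ x := by
            simp only [hh]; rw [max_eq_left (by linarith)]; ring
          rw [this]
      _ ≤ liminf (fun n => ∫⁻ x in Ω, ENNReal.ofReal (h (u n) x - h e₀ x)) atTop := by
          refine lintegral_liminf_le' fun n => ?_
          refine AEMeasurable.ennreal_ofReal (AEMeasurable.sub ?_ (hint e₀ he₀).aemeasurable)
          exact aemeasurable_const.sub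
            ((aemeasurable_const.sub hσ.measurable_fun).max aemeasurable_const)
      _ ≤ ENNReal.ofReal (M - c₀) := by
          refine liminf_le_of_frequently_le' (Eventually.frequently ?_)
          filter_upwards [hu1, hu2 e₀ he₀] with n hn1 hn2
          rw [← ofReal_integral_eq_lintegral_ofReal (f := fun x => h (u n) x - h e₀ x)
            ((hint _ hn1).sub (hint _ he₀)) (Eventually.of_forall fun x => sub_nonneg.2 (hmono _ _ x hn2.le)),
            integral_sub (hint _ hn1) (hint _ he₀), hval _ hn1, hval _ he₀]
          exact ENNReal.ofReal_le_ofReal (by linarith [hM (u n) hn2.le hn1])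
  have hnn : 0 ≤ᵐ[volume.restrict Ω] fun x => σ x - h e₀ x :=
    Eventually.of_forall fun x => sub_nonneg.2 (hle _ x)
  have hi : Integrable (fun x => σ x - h e₀ x) (volume.restrict Ω) :=
    (lintegral_ofReal_ne_top_iff_integrable hσ0.aestronglyMeasurable hnn).1
      (ne_top_of_le_ne_top ENNReal.ofReal_ne_top hlim)
  have hi' : Integrable σ (volume.restrict Ω) := by
    exact (hi.add (hint e₀ he₀)).congr (Eventually.of_forall fun x => sub_add_cancel _ _)
  refine ⟨hi', ?_⟩
  rw [← ofReal_integral_eq_lintegral_ofReal hi hnn, integral_sub hi' (hint e₀ he₀),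
    hval _ he₀, ENNReal.ofReal_le_ofReal_iff (by linarith)] at hlim
  linarith

theorem extIntegral_eq_top (hσ : Admissible Ω σ)
    (hB : ∀ μ : ℝ≥0∞, μ < volume Ω → IntegrableOn σ (sublevel Ω σ μ) volume)
    (hV : volume Ω ≠ ⊤) (hni : ¬ Integrable σ (volume.restrict Ω)) :
    extIntegral (volume.restrict Ω) (fun x => (σ x : EReal)) = ⊤ := by
  refine RefinedHL.extIntegral_eq_top hσ.measurable_fun ?_ hni
  have := hσ.lintegral_neg_ne_top hB (A := univ) (by simpa using hV)
  rwa [setLIntegral_univ] at this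

theorem eMax_mul_ne_bot (hσ : Admissible Ω σ) {y : ℝ≥0∞} (hy : y ≠ ⊤) :
    eMax Ω σ * (y : EReal) ≠ ⊥ := by
  obtain ⟨e, he⟩ := hσ.exists_lt_eMax
  have h : (e : EReal) * y ≤ eMax Ω σ * y :=
    mul_le_mul_of_nonneg_right he.le (EReal.coe_ennreal_nonneg _)
  rw [← EReal.coe_ennreal_toReal hy, ← EReal.coe_mul] at h
  rw [← EReal.coe_ennreal_toReal hy]
  exact ((EReal.bot_lt_coe _).trans_le h).ne'

theorem bigBExt_of_not_integrable (hσ : Admissible Ω σ)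
    (hB : ∀ μ : ℝ≥0∞, μ < volume Ω → IntegrableOn σ (sublevel Ω σ μ) volume)
    {m : ℝ≥0∞} (hm : volume Ω ≤ m) (hmt : m ≠ ⊤) (hni : ¬ Integrable σ (volume.restrict Ω)) :
    bigBExt Ω σ m = ⊤ := by
  rw [bigBExt, if_neg hm.not_gt, hσ.extIntegral_eq_top hB (ne_top_of_le_ne_top hmt hm) hni]
  exact EReal.top_add_of_ne_bot
    (hσ.eMax_mul_ne_bot (ne_top_of_le_ne_top hmt tsub_le_self))

/-- Write $m=|\Omega|+y$. Both $e|\Omega|-\int_\Omega(e-\sigma)_+$ and $ey$ are nondecreasing in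
$e$, so the supremum of their sum is the sum of the suprema, $\int_\Omega\sigma+e_{\max}y$. If
$\sigma$ is not integrable, both sides are $+\infty$. -/
theorem bigBExt_eq (hσ : Admissible Ω σ)
    (hB : ∀ μ : ℝ≥0∞, μ < volume Ω → IntegrableOn σ (sublevel Ω σ μ) volume) {m : ℝ≥0∞}
    (hm : m ≠ ⊤) : bigBExt Ω σ m = conjExcess Ω σ m.toReal := by
  rcases lt_or_ge m (volume Ω) with hmV | hmV
  · rw [bigBExt, if_pos hmV, hσ.coe_bigB hB hmV]
  have hV : volume Ω ≠ ⊤ := ne_top_of_le_ne_top hm hmV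
  obtain ⟨y, hy⟩ : ∃ y : ℝ≥0, m = volume Ω + y := by
    obtain ⟨y, rfl⟩ := le_iff_exists_add.1 hmV
    lift y to ℝ≥0 using (ENNReal.add_ne_top.1 hm).2
    exact ⟨y, rfl⟩
  have hym : m.toReal = (volume Ω).toReal + y := by
    rw [hy, ENNReal.toReal_add hV ENNReal.coe_ne_top, ENNReal.coe_toReal]
  obtain ⟨e₀, he₀⟩ := hσ.exists_lt_eMax
  by_cases hi : Integrable σ (volume.restrict Ω)
  · have hsub : m - volume Ω = y := by rw [hy, ENNReal.add_sub_cancel_left hV]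
    rw [bigBExt, if_neg hmV.not_gt, extIntegral_of_integrable hi, hsub]
    have hcoe : (((y : ℝ≥0∞) : EReal)) = ((y : ℝ) : EReal) := rfl
    rw [hcoe]
    apply le_antisymm
    · refine EReal.add_le_of_forall_lt fun a ha b hb => ?_
      obtain ⟨e₁, he₁, hae₁⟩ : ∃ e : ℝ, (e : EReal) < eMax Ω σ ∧
          a ≤ ((e * (volume Ω).toReal - excess Ω σ e : ℝ) : EReal) := by
        by_contra! hcon
        obtain ⟨z, haz, hz⟩ := EReal.lt_iff_exists_real_btwn.1 ha
        have := (hσ.integral_le_of_bound hB hV (M := z) he₀ fun e _ he =>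
          EReal.coe_le_coe_iff.1 ((hcon e he).trans haz).le).2
        exact (EReal.coe_lt_coe_iff.1 hz).not_ge this
      obtain ⟨e₂, he₂, hbe₂⟩ : ∃ e : ℝ, (e : EReal) < eMax Ω σ ∧ b ≤ ((e * y : ℝ) : EReal) := by
        obtain ⟨z, hbz, hz⟩ := EReal.lt_iff_exists_real_btwn.1 hb
        rcases y.2.eq_or_lt with hy0 | hy0
        · refine ⟨e₀, he₀, ?_⟩
          have hy0 : (y : ℝ) = 0 := hy0.symm
          rw [hy0] at hb ⊢
          simpa using hb.le
        · have hy0 : 0 < (y : ℝ) := hy0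
          -- Chosen so that $e_2y=z$, a real number strictly between $b$ and $e_{\max}y$.
          refine ⟨z / y, ?_, ?_⟩
          · induction h : eMax Ω σ with
            | bot => exact absurd h hσ.bot_lt_eMax.ne'
            | top => exact EReal.coe_lt_top _
            | coe r =>
              rw [h, ← EReal.coe_mul, EReal.coe_lt_coe_iff] at hz
              exact EReal.coe_lt_coe_iff.2 ((div_lt_iff₀ hy0).2 hz)
          · rw [div_mul_cancel₀ _ hy0.ne']
            exact hbz.le
      have hmax : ((max e₁ e₂ : ℝ) : EReal) < eMax Ω σ := by
        rcases max_cases e₁ e₂ with h | h <;> rw [h.1] <;> assumption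
      refine le_trans ?_ (le_conjExcess hmax _)
      refine (add_le_add hae₁ hbe₂).trans ?_
      rw [← EReal.coe_add, EReal.coe_le_coe_iff, hym]
      have h1 := hσ.excess_sub_le hB (le_max_left e₁ e₂) hmax
      have h2 : (jac Ω σ (max e₁ e₂)).toReal ≤ (volume Ω).toReal :=
        ENNReal.toReal_mono hV (jac_le _)
      have h3 : e₂ * y ≤ max e₁ e₂ * y := mul_le_mul_of_nonneg_right (le_max_right _ _) y.2
      have h4 := mul_le_mul_of_nonneg_left h2 (sub_nonneg.2 (le_max_left e₁ e₂))
      linarith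
    · refine conjExcess_le fun e he => ?_
      have h1 : e * (volume Ω).toReal - excess Ω σ e ≤ ∫ x in Ω, σ x := by
        simpa using hσ.le_setIntegral hB (A := univ) (by simpa using hV) hi.integrableOn he
      rw [hym, show e * ((volume Ω).toReal + y) - excess Ω σ e =
        (e * (volume Ω).toReal - excess Ω σ e) + e * y by ring, EReal.coe_add, EReal.coe_mul]
      exact add_le_add (EReal.coe_le_coe_iff.2 h1)
        (mul_le_mul_of_nonneg_right he.le (EReal.coe_nonneg.2 y.2))
  · rw [hσ.bigBExt_of_not_integrable hB hmV hm hi]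
    by_contra hne
    refine hi (hσ.integral_le_of_bound hB hV (e₀ := e₀)
      (M := (conjExcess Ω σ m.toReal).toReal - e₀ * y) he₀ fun e hee he => ?_).1
    have h1 := le_conjExcess he m.toReal
    rw [← EReal.coe_toReal (Ne.symm hne) (hσ.bot_lt_conjExcess _).ne', EReal.coe_le_coe_iff, hym] at h1
    have h2 : e₀ * y ≤ e * y := mul_le_mul_of_nonneg_right hee y.2
    rw [hym]
    linarith

theorem setIntegral_rank_lt (hσ : Admissible Ω σ)
    (hB : ∀ μ : ℝ≥0∞, μ < volume Ω → IntegrableOn σ (sublevel Ω σ μ) volume) {m : ℝ≥0∞}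
    (hm : m ≤ volume Ω) (hmt : m ≠ ⊤) (hfin : bigBExt Ω σ m ≠ ⊤) :
    IntegrableOn σ {x | jac Ω σ (σ x) < m} (volume.restrict Ω) ∧
      bigBExt Ω σ m = ((∫ x in {x | jac Ω σ (σ x) < m}, σ x ∂volume.restrict Ω : ℝ) : EReal) := by
  rcases hm.lt_or_eq with hmV | rfl
  · refine ⟨hσ.integrableOn_rank_lt hB hmV, ?_⟩
    rw [bigBExt, if_pos hmV, hσ.bigB_eq]
  · have hi : Integrable σ (volume.restrict Ω) := by
      by_contra hni
      exact hfin (hσ.bigBExt_of_not_integrable hB le_rfl hmt hni)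
    refine ⟨hi.integrableOn, ?_⟩
    have hae : {x | jac Ω σ (σ x) < volume Ω} =ᵐ[volume.restrict Ω] univ := by
      filter_upwards [hσ.ae_lt_eMax hmt] with x hx
      exact propext ⟨fun _ => trivial, fun _ => hσ.jac_lt hx⟩
    rw [setIntegral_congr_set hae, setIntegral_univ, bigBExt, if_neg (lt_irrefl _),
      extIntegral_of_integrable hi]
    simp

end Admissible

end Extension

/-! ### Convexity and slope bounds for the Legendre transform. -/

section Slopes

variable {d : ℕ} {Ω : Set (EuclideanSpace ℝ (Fin d))} {σ : EuclideanSpace ℝ (Fin d) → ℝ}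

theorem lt_jac_of_jacInv_lt {κ : ℝ≥0∞} {t : ℝ} (h : jacInv Ω σ κ < t) (ht : (t : EReal) < eMax Ω σ) :
    κ < jac Ω σ t := by
  by_contra! hle
  exact h.not_ge (le_sSup ⟨t, ⟨ht, hle⟩, rfl⟩)

theorem exists_of_lt_jacInv {κ : ℝ≥0∞} {t : ℝ} (h : (t : EReal) < jacInv Ω σ κ) :
    ∃ t' : ℝ, t < t' ∧ (t' : EReal) < eMax Ω σ ∧ jac Ω σ t' ≤ κ := by
  obtain ⟨_, ⟨t', ht', rfl⟩, htt⟩ := lt_sSup_iff.1 h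
  exact ⟨t', EReal.coe_lt_coe_iff.1 htt, ht'⟩

theorem conjExcess_midpoint {x y c₁ c₂ : ℝ} (h₁ : conjExcess Ω σ (x + y) ≤ c₁)
    (h₂ : conjExcess Ω σ (x - y) ≤ c₂) : conjExcess Ω σ x ≤ ((c₁ + c₂) / 2 : ℝ) := by
  refine conjExcess_le fun e he => ?_
  have h₁ := EReal.coe_le_coe_iff.1 ((le_conjExcess he _).trans h₁)
  have h₂ := EReal.coe_le_coe_iff.1 ((le_conjExcess he _).trans h₂)
  exact EReal.coe_le_coe_iff.2 (by linarith)

namespace Admissible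

theorem convexOn_bigB (hσ : Admissible Ω σ)
    (hB : ∀ μ : ℝ≥0∞, μ < volume Ω → IntegrableOn σ (sublevel Ω σ μ) volume) :
    ConvexOn ℝ {m : ℝ | 0 ≤ m ∧ ENNReal.ofReal m < volume Ω}
      (fun m => bigB Ω σ (ENNReal.ofReal m)) := by
  have hconv : Convex ℝ {m : ℝ | 0 ≤ m ∧ ENNReal.ofReal m < volume Ω} := by
    refine OrdConnected.convex ⟨fun x hx y hy z hz => ⟨hx.1.trans hz.1, ?_⟩⟩
    exact (ENNReal.ofReal_le_ofReal hz.2).trans_lt hy.2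
  refine ⟨hconv, fun x hx y hy a b ha hb hab => ?_⟩
  have hxy := hconv hx hy ha hb hab
  have hx' := hσ.coe_bigB hB hx.2
  have hy' := hσ.coe_bigB hB hy.2
  rw [← EReal.coe_le_coe_iff, hσ.coe_bigB hB hxy.2, ENNReal.toReal_ofReal hxy.1]
  rw [ENNReal.toReal_ofReal hx.1] at hx'
  rw [ENNReal.toReal_ofReal hy.1] at hy'
  refine conjExcess_le fun e he => EReal.coe_le_coe_iff.2 ?_
  have h1 := EReal.coe_le_coe_iff.1 ((le_conjExcess he x).trans hx'.ge)
  have h2 := EReal.coe_le_coe_iff.1 ((le_conjExcess he y).trans hy'.ge)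
  have h3 := mul_le_mul_of_nonneg_left h1 ha
  have h4 := mul_le_mul_of_nonneg_left h2 hb
  have h5 : excess Ω σ e = a * excess Ω σ e + b * excess Ω σ e := by rw [← add_mul, hab, one_mul]
  simp only [smul_eq_mul]
  linarith

/-- To the right of $a_\sigma(t)$ the slopes are at least $t$: at $x\ge a_\sigma(t)$ the affine
function of any $e<t$ is dominated by that of $t$, and those with $e\ge t$ drop by at least
$(x'-x)t$ from $x'$ to $x$. -/
theorem conjExcess_le_sub (hσ : Admissible Ω σ)
    (hB : ∀ μ : ℝ≥0∞, μ < volume Ω → IntegrableOn σ (sublevel Ω σ μ) volume)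
    {x x' c t : ℝ} (hxx : x ≤ x') (ht : (t : EReal) < eMax Ω σ) (htx : (jac Ω σ t).toReal ≤ x)
    (hc : conjExcess Ω σ x' ≤ c) : conjExcess Ω σ x ≤ ((c - (x' - x) * t : ℝ) : EReal) := by
  refine conjExcess_le fun e he => EReal.coe_le_coe_iff.2 ?_
  rcases le_total t e with hte | hte
  · have h1 := EReal.coe_le_coe_iff.1 ((le_conjExcess he _).trans hc)
    have h2 := mul_le_mul_of_nonneg_left hte (sub_nonneg.2 hxx)
    linarith
  · have h1 := EReal.coe_le_coe_iff.1 ((le_conjExcess ht _).trans hc)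
    have h2 := hσ.excess_sub_le hB hte ht
    have h3 := mul_le_mul_of_nonneg_left htx (sub_nonneg.2 hte)
    linarith

/-- Dual bound: if $t>b_\sigma(\kappa)$, then any $e>t$ is dominated by $t$ at
$x'\le\kappa<a_\sigma(t)$, and those with $e\le t$ rise by at most $(x'-x)t$. -/
theorem conjExcess_le_add (hσ : Admissible Ω σ)
    (hB : ∀ μ : ℝ≥0∞, μ < volume Ω → IntegrableOn σ (sublevel Ω σ μ) volume)
    {x x' c t : ℝ} {κ : ℝ≥0∞} (hxx : x ≤ x') (hκ : x' ≤ κ.toReal) (ht : jacInv Ω σ κ < t)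
    (hc : conjExcess Ω σ x ≤ c) : conjExcess Ω σ x' ≤ ((c + (x' - x) * t : ℝ) : EReal) := by
  refine conjExcess_le fun e he => EReal.coe_le_coe_iff.2 ?_
  rcases le_or_gt e t with hte | hte
  · have h1 := EReal.coe_le_coe_iff.1 ((le_conjExcess he _).trans hc)
    have h2 := mul_le_mul_of_nonneg_left hte (sub_nonneg.2 hxx)
    linarith
  · have ht' : (t : EReal) < eMax Ω σ := (EReal.coe_lt_coe_iff.2 hte).trans he
    have h1 := EReal.coe_le_coe_iff.1 ((le_conjExcess ht' _).trans hc)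
    have h2 := hσ.le_excess_sub hB hte.le he
    have h3 : x' ≤ (jac Ω σ t).toReal := hκ.trans
      (ENNReal.toReal_mono (hσ.jac_lt ht').ne_top (lt_jac_of_jacInv_lt ht ht').le)
    have h4 := mul_le_mul_of_nonneg_left h3 (sub_nonneg.2 hte.le)
    linarith

/-- Comparison of `B_σ` at two points through the slopes `b_σ`. -/
theorem conjExcess_le_of_slopes (hσ : Admissible Ω σ)
    (hB : ∀ μ : ℝ≥0∞, μ < volume Ω → IntegrableOn σ (sublevel Ω σ μ) volume)
    {m n b : ℝ≥0∞} (hm : m ≠ ⊤) (hn : n ≠ ⊤) (hb : b ≤ m) {c : ℝ}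
    (hc : conjExcess Ω σ (n.toReal + b.toReal) ≤ c)
    (htop : ((m - n : ℝ≥0∞) : EReal) * jacInv Ω σ (2 * m)
      - ((n - m : ℝ≥0∞) : EReal) * jacInv Ω σ m ≠ ⊤) :
    ∃ r : ℝ, ((m - n : ℝ≥0∞) : EReal) * jacInv Ω σ (2 * m)
      - ((n - m : ℝ≥0∞) : EReal) * jacInv Ω σ m = r ∧
      conjExcess Ω σ (m.toReal + b.toReal) ≤ ((c + r : ℝ) : EReal) := by
  have hbm : b.toReal ≤ m.toReal := ENNReal.toReal_mono hm hb
  have hbot := hσ.bot_lt_conjExcess (m.toReal + b.toReal)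
  rcases lt_trichotomy n m with h | h | h
  · have hδ : ((m - n : ℝ≥0∞) : EReal) = ((m.toReal - n.toReal : ℝ) : EReal) := by
      rw [← ENNReal.toReal_sub_of_le h.le hm, EReal.coe_ennreal_toReal (ENNReal.sub_ne_top hm)]
    have hδ0 : 0 < m.toReal - n.toReal := sub_pos.2 ((ENNReal.toReal_lt_toReal hn hm).2 h)
    -- The argument $2m$ of $b_\sigma$ appears because $m+b\le2m$.
    have key : ∀ t : ℝ, jacInv Ω σ (2 * m) < t → conjExcess Ω σ (m.toReal + b.toReal) ≤
        ((c + (m.toReal - n.toReal) * t : ℝ) : EReal) := fun t ht => by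
      have := hσ.conjExcess_le_add hB (x' := m.toReal + b.toReal) (by linarith)
        (by simp only [ENNReal.toReal_mul, ENNReal.toReal_ofNat]; linarith) ht hc
      convert this using 3
      ring
    rw [tsub_eq_zero_of_le h.le, hδ] at htop ⊢
    simp only [EReal.coe_ennreal_zero, zero_mul, sub_zero] at htop ⊢
    induction hj : jacInv Ω σ (2 * m) with
    | bot =>
      obtain ⟨z, hz1, hz2⟩ := EReal.lt_iff_exists_real_btwn.1 hbot
      -- The slope is tuned to make the bound exactly $z$, here below the value it bounds: slope
      -- $-\infty$ is impossible.
      have := key ((z - c) / (m.toReal - n.toReal)) (by rw [hj]; exact EReal.bot_lt_coe _)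
      rw [mul_div_cancel₀ _ hδ0.ne', add_sub_cancel] at this
      exact absurd this hz2.not_ge
    | top => exact absurd (by rw [hj]; exact EReal.coe_mul_top_of_pos hδ0) htop
    | coe r =>
      refine ⟨(m.toReal - n.toReal) * r, (EReal.coe_mul _ _).symm, ?_⟩
      refine EReal.le_of_forall_lt_iff_le.1 fun z hz => ?_
      have hz := EReal.coe_lt_coe_iff.1 hz
      have := key ((z - c) / (m.toReal - n.toReal)) (by
        rw [hj, EReal.coe_lt_coe_iff, lt_div_iff₀ hδ0]; linarith)
      rwa [mul_div_cancel₀ _ hδ0.ne', add_sub_cancel] at this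
  · subst h
    exact ⟨0, by simp, by simpa using hc⟩
  · have hδ : ((n - m : ℝ≥0∞) : EReal) = ((n.toReal - m.toReal : ℝ) : EReal) := by
      rw [← ENNReal.toReal_sub_of_le h.le hn, EReal.coe_ennreal_toReal (ENNReal.sub_ne_top hn)]
    have hδ0 : 0 < n.toReal - m.toReal := sub_pos.2 ((ENNReal.toReal_lt_toReal hm hn).2 h)
    -- For $n>m$ the interval is $[m+b,n+b]$, to the right of $m$, so $b_\sigma(m)$ bounds its
    -- slopes from below.
    have key : ∀ t : ℝ, (t : EReal) < jacInv Ω σ m → conjExcess Ω σ (m.toReal + b.toReal) ≤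
        ((c - (n.toReal - m.toReal) * t : ℝ) : EReal) := fun t ht => by
      obtain ⟨t', htt, ht', hj⟩ := exists_of_lt_jacInv ht
      have h1 := ENNReal.toReal_mono hm hj
      have := hσ.conjExcess_le_sub hB (x := m.toReal + b.toReal) (by linarith) ht'
        (h1.trans (by linarith [ENNReal.toReal_nonneg (a := b)])) hc
      refine this.trans (EReal.coe_le_coe_iff.2 ?_)
      have := mul_le_mul_of_nonneg_left htt.le hδ0.le
      linarith
    rw [tsub_eq_zero_of_le h.le, hδ] at htop ⊢
    simp only [EReal.coe_ennreal_zero, zero_mul, zero_sub] at htop ⊢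
    induction hj : jacInv Ω σ m with
    | bot => exact absurd (by rw [hj, EReal.coe_mul_bot_of_pos hδ0]; rfl) htop
    | top =>
      obtain ⟨z, hz1, hz2⟩ := EReal.lt_iff_exists_real_btwn.1 hbot
      have := key ((c - z) / (n.toReal - m.toReal)) (by rw [hj]; exact EReal.coe_lt_top _)
      rw [mul_div_cancel₀ _ hδ0.ne', sub_sub_cancel] at this
      exact absurd this hz2.not_ge
    | coe r =>
      refine ⟨-((n.toReal - m.toReal) * r), by rw [EReal.coe_neg, EReal.coe_mul], ?_⟩
      refine EReal.le_of_forall_lt_iff_le.1 fun z hz => ?_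
      have hz := EReal.coe_lt_coe_iff.1 hz
      have := key ((c - z) / (n.toReal - m.toReal)) (by
        rw [hj, EReal.coe_lt_coe_iff, div_lt_iff₀ hδ0]; linarith)
      rwa [mul_div_cancel₀ _ hδ0.ne', sub_sub_cancel] at this

theorem secondDiff_eq (hσ : Admissible Ω σ)
    (hB : ∀ μ : ℝ≥0∞, μ < volume Ω → IntegrableOn σ (sublevel Ω σ μ) volume)
    {m b : ℝ≥0∞} (hm : m ≠ ⊤) (hb : b ≤ m) :
    secondDiff Ω σ m b = conjExcess Ω σ (m.toReal + b.toReal) +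
      conjExcess Ω σ (m.toReal - b.toReal) - 2 * conjExcess Ω σ m.toReal := by
  have hbt : b ≠ ⊤ := ne_top_of_le_ne_top hm hb
  rw [secondDiff, hσ.bigBExt_eq hB (ENNReal.add_ne_top.2 ⟨hm, hbt⟩),
    hσ.bigBExt_eq hB (ENNReal.sub_ne_top hm), hσ.bigBExt_eq hB hm,
    ENNReal.toReal_add hm hbt, ENNReal.toReal_sub_of_le hb hm]

theorem secondDiff_nonneg (hσ : Admissible Ω σ)
    (hB : ∀ μ : ℝ≥0∞, μ < volume Ω → IntegrableOn σ (sublevel Ω σ μ) volume)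
    {m b : ℝ≥0∞} (hm : m ≠ ⊤) (hb : b ≤ m) (hfin : bigBExt Ω σ m ≠ ⊤) :
    0 ≤ secondDiff Ω σ m b := by
  rw [hσ.secondDiff_eq hB hm hb]
  rw [hσ.bigBExt_eq hB hm] at hfin
  have h0 := (hσ.bot_lt_conjExcess m.toReal).ne'
  have h1 := (hσ.bot_lt_conjExcess (m.toReal + b.toReal)).ne'
  have h2 := (hσ.bot_lt_conjExcess (m.toReal - b.toReal)).ne'
  have h3 : (2 : EReal) * conjExcess Ω σ m.toReal =
      ((2 * (conjExcess Ω σ m.toReal).toReal : ℝ) : EReal) := by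
    rw [EReal.coe_mul, EReal.coe_toReal hfin h0]; rfl
  rw [h3]
  by_cases h4 : conjExcess Ω σ (m.toReal + b.toReal) = ⊤
  · rw [h4, EReal.top_add_of_ne_bot h2, EReal.top_sub_coe]
    exact le_top
  by_cases h5 : conjExcess Ω σ (m.toReal - b.toReal) = ⊤
  · rw [h5, EReal.add_top_of_ne_bot h1, EReal.top_sub_coe]
    exact le_top
  have h6 := conjExcess_midpoint (EReal.coe_toReal h4 h1).ge (EReal.coe_toReal h5 h2).ge
  rw [← EReal.coe_toReal hfin h0, EReal.coe_le_coe_iff] at h6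
  rw [← EReal.coe_toReal h4 h1, ← EReal.coe_toReal h5 h2, ← EReal.coe_add, ← EReal.coe_sub]
  exact EReal.coe_nonneg.2 (by linarith)

end Admissible

end Slopes

/-! ### The inequality at a fixed height. -/

section Pointwise

variable {d : ℕ} {Ω : Set (EuclideanSpace ℝ (Fin d))} {σ : EuclideanSpace ℝ (Fin d) → ℝ}

theorem correction_eq (hd : 1 ≤ d) (hΩ : NullMeasurableSet Ω volume) (hV : volume Ω ≠ 0)
    {f q : EuclideanSpace ℝ (Fin d) → ℝ} (hf : NonnegL1 Ω f) (hq : NonnegL1 Ω q) {s : ℝ}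
    (hs : 0 < s) :
    correction Ω σ f q s =
      ((distrib Ω q s - distrib Ω f s : ℝ≥0∞) : EReal) * jacInv Ω σ (2 * distrib Ω q s)
      - ((distrib Ω f s - distrib Ω q s : ℝ≥0∞) : EReal) * jacInv Ω σ (distrib Ω q s) := by
  rw [correction, beta_rearr hd hΩ hV hf hq hs, beta_rearr hd hΩ hV hq hf hs]

theorem Admissible.beta_le_distrib (hσ : Admissible Ω σ)
    {q : EuclideanSpace ℝ (Fin d) → ℝ} (hq : NonnegL1 Ω q) (f : EuclideanSpace ℝ (Fin d) → ℝ)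
    {s : ℝ} (hs : 0 ≤ s) : beta Ω f (sigmaRearr Ω σ q) s ≤ distrib Ω q s := by
  rw [beta_eq hσ.measurable_domain, ← hσ.measure_lt_sigmaRearr hq hs]
  exact measure_mono fun x hx => hx.2

/-- The comparison of the energies of the level sets at height `s`, with positive and negative
parts on the two sides. -/
theorem Admissible.level_inequality (hd : 1 ≤ d) (hσ : Admissible Ω σ)
    (hB : ∀ μ : ℝ≥0∞, μ < volume Ω → IntegrableOn σ (sublevel Ω σ μ) volume)
    {f q : EuclideanSpace ℝ (Fin d) → ℝ} (hf : NonnegL1 Ω f) (hq : NonnegL1 Ω q) {s : ℝ}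
    (hs : 0 < s) (hfin : bigBExt Ω σ (distrib Ω q s) ≠ ⊤) :
    ((∫⁻ x in {x | sigmaRearr Ω σ q x ≤ s ∧ s < f x}, ENNReal.ofReal (-σ x) ∂volume.restrict Ω) +
      ∫⁻ x in {x | f x ≤ s ∧ s < sigmaRearr Ω σ q x}, ENNReal.ofReal (σ x) ∂volume.restrict Ω) +
      ((secondDiff Ω σ (distrib Ω q s) (beta Ω f (sigmaRearr Ω σ q) s)).toENNReal +
        (-correction Ω σ f q s).toENNReal) ≤
    ((∫⁻ x in {x | sigmaRearr Ω σ q x ≤ s ∧ s < f x}, ENNReal.ofReal (σ x) ∂volume.restrict Ω) +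
      ∫⁻ x in {x | f x ≤ s ∧ s < sigmaRearr Ω σ q x}, ENNReal.ofReal (-σ x) ∂volume.restrict Ω) +
      (correction Ω σ f q s).toENNReal := by
  set ν := volume.restrict Ω
  set g := sigmaRearr Ω σ q
  set G := {x | s < g x}
  set P := {x | s < f x}
  set m := distrib Ω q s
  set n := distrib Ω f s
  set b := beta Ω f g s
  have hE : {x | g x ≤ s ∧ s < f x} = P \ G := by
    ext x; exact and_comm.trans (and_congr Iff.rfl not_lt.symm)
  have hF : {x | f x ≤ s ∧ s < g x} = G \ P := by
    ext x; exact and_comm.trans (and_congr Iff.rfl not_lt.symm)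
  have hmt : m ≠ ⊤ := distrib_ne_top hσ.measurable_domain hq hs
  have hnt : n ≠ ⊤ := distrib_ne_top hσ.measurable_domain hf hs
  have hG : NullMeasurableSet G ν :=
    nullMeasurableSet_lt aemeasurable_const (hσ.aemeasurable_sigmaRearr q)
  have hP : NullMeasurableSet P ν := nullMeasurableSet_lt aemeasurable_const hf.1.aemeasurable
  have hνG : ν G = m := hσ.measure_lt_sigmaRearr hq hs.le
  have hνP : ν P = n := (distrib_eq hσ.measurable_domain s).symm
  have hνF : ν (G \ P) = b := by rw [← hF]; exact (beta_eq hσ.measurable_domain s).symm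
  have hbm : b ≤ m := hσ.beta_le_distrib hq f hs.le
  have hbt : b ≠ ⊤ := ne_top_of_le_ne_top hmt hbm
  rw [hE, hF]
  have hEt : ν (P \ G) ≠ ⊤ := ne_top_of_le_ne_top (hνP ▸ hnt) (measure_mono sdiff_subset)
  -- An infinite term on the right is trivial; otherwise $\sigma$ is integrable on $P\setminus G$,
  -- since its negative part is integrable on sets of finite measure.
  by_cases hEP : ∫⁻ x in P \ G, ENNReal.ofReal (σ x) ∂ν = ⊤
  · rw [hEP]; simp
  by_cases hct : correction Ω σ f q s = ⊤
  · rw [hct]; simp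
  have hGae : {x | jac Ω σ (σ x) < m} =ᵐ[ν] G := by
    filter_upwards [hσ.ae_lt_sigmaRearr_iff hq] with x hx
    exact propext (hx s hs.le).symm
  obtain ⟨hiG, hBm⟩ := hσ.setIntegral_rank_lt hB (distrib_le s) hmt hfin
  rw [setIntegral_congr_set hGae] at hBm
  replace hiG : IntegrableOn σ G ν := hiG.congr_set_ae hGae.symm
  have hEN := hσ.lintegral_neg_ne_top hB hEt
  have hiE : IntegrableOn σ (P \ G) ν :=
    integrable_of_lintegral_ofReal (hσ.measurable_fun.mono_measure Measure.restrict_le_self) hEP hEN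
  have hiF : IntegrableOn σ (G \ P) ν := hiG.mono_set sdiff_subset
  have hFP : ∫⁻ x in G \ P, ENNReal.ofReal (σ x) ∂ν ≠ ⊤ := Integrable.lintegral_lt_top hiF |>.ne
  have hFN : ∫⁻ x in G \ P, ENNReal.ofReal (-σ x) ∂ν ≠ ⊤ :=
    Integrable.lintegral_lt_top hiF.neg |>.ne
  -- the intersection
  have h1 : conjExcess Ω σ (m.toReal - b.toReal) ≤
      ((∫ x in G, σ x ∂ν - ∫ x in G \ P, σ x ∂ν : ℝ) : EReal) := by
    have hint := integral_inter_add_sdiff₀ hP hiG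
    have hmeas := measure_inter_add_sdiff₀ (μ := ν) G hP
    rw [hνF, hνG] at hmeas
    have hI : ν (G ∩ P) ≠ ⊤ := ne_top_of_le_ne_top (hνG ▸ hmt) (measure_mono inter_subset_left)
    have := hσ.conjExcess_le_setIntegral hB hI (hiG.mono_set inter_subset_left)
    rw [← hmeas, ENNReal.toReal_add hI hbt, add_sub_cancel_right, ← hint, add_sub_cancel_right]
    exact this
  -- the union
  have h2 : conjExcess Ω σ (n.toReal + b.toReal) ≤
      ((∫ x in G, σ x ∂ν + ∫ x in P \ G, σ x ∂ν : ℝ) : EReal) := by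
    have hiU : IntegrableOn σ (G ∪ P) ν := by
      rw [← union_sdiff_self]; exact hiG.union hiE
    have hint := integral_inter_add_sdiff₀ hG hiU
    rw [union_inter_cancel_left, union_sdiff_left] at hint
    have hmeas := measure_inter_add_sdiff₀ (μ := ν) (G ∪ P) hP
    rw [union_inter_cancel_right, union_sdiff_right, hνF, hνP] at hmeas
    have := hσ.conjExcess_le_setIntegral hB
      (A := G ∪ P) (by rw [← hmeas]; exact ENNReal.add_ne_top.2 ⟨hnt, hbt⟩) hiU
    rwa [← hmeas, ENNReal.toReal_add hnt hbt, ← hint] at this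
  have hcorr := correction_eq (σ := σ) hd hσ.measurable_domain hσ.volume_ne_zero hf hq hs
  rw [hcorr] at hct
  -- Replaces $n+b$ by $m+b$; the real number $r$ is the correction at height $s$.
  obtain ⟨r, hr, h3⟩ := hσ.conjExcess_le_of_slopes hB hmt hnt hbm h2 hct
  rw [hcorr, hr]
  have h1b := (hσ.bot_lt_conjExcess (m.toReal - b.toReal)).ne'
  have h3b := (hσ.bot_lt_conjExcess (m.toReal + b.toReal)).ne'
  have h1t := ne_top_of_le_ne_top (EReal.coe_ne_top _) h1
  have h3t := ne_top_of_le_ne_top (EReal.coe_ne_top _) h3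
  have hnn := hσ.secondDiff_nonneg hB hmt hbm hfin
  have hsec : secondDiff Ω σ m b =
      (((conjExcess Ω σ (m.toReal + b.toReal)).toReal +
        (conjExcess Ω σ (m.toReal - b.toReal)).toReal - 2 * ∫ x in G, σ x ∂ν : ℝ) : EReal) := by
    rw [hσ.secondDiff_eq hB hmt hbm, EReal.coe_sub, EReal.coe_add, EReal.coe_toReal h1t h1b,
      EReal.coe_toReal h3t h3b, ← hσ.bigBExt_eq hB hmt, hBm, EReal.coe_mul]
    rfl
  rw [← EReal.coe_toReal h1t h1b, EReal.coe_le_coe_iff] at h1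
  rw [← EReal.coe_toReal h3t h3b, EReal.coe_le_coe_iff] at h3
  rw [hsec] at hnn ⊢
  rw [EReal.coe_nonneg] at hnn
  have hE' := integral_eq_lintegral_pos_part_sub_lintegral_neg_part hiE
  have hF' := integral_eq_lintegral_pos_part_sub_lintegral_neg_part hiF
  rw [← EReal.coe_neg, EReal.real_coe_toENNReal, EReal.real_coe_toENNReal, EReal.real_coe_toENNReal]
  rw [← ENNReal.toReal_le_toReal (by finiteness) (by finiteness)]
  rw [ENNReal.toReal_add (by finiteness) (by finiteness),
    ENNReal.toReal_add (by finiteness) (by finiteness),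
    ENNReal.toReal_add (by finiteness) (by finiteness),
    ENNReal.toReal_add (by finiteness) (by finiteness),
    ENNReal.toReal_add (by finiteness) (by finiteness),
    ENNReal.toReal_ofReal hnn, ENNReal.toReal_ofReal', ENNReal.toReal_ofReal']
  rcases max_cases r 0 with h4 | h4 <;> rcases max_cases (-r) 0 with h5 | h5 <;>
    rw [h4.1, h5.1] <;> linarith

end Pointwise

/-! ### Layer-cake formulas for differences. -/

section LayerCake

variable {α : Type*} [MeasurableSpace α] {ν : Measure α} {f g : α → ℝ} {w : α → ℝ≥0∞}

theorem aemeasurable_level_indicator (hf : AEMeasurable f ν) (hg : AEMeasurable g ν)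
    (hw : AEMeasurable w ν) :
    AEMeasurable (fun p : ℝ × α => {x | g x ≤ p.1 ∧ p.1 < f x}.indicator w p.2)
      ((volume.restrict (Ioi (0 : ℝ))).prod ν) := by
  have hq : Measure.QuasiMeasurePreserving (Prod.snd : ℝ × α → α)
    ((volume.restrict (Ioi (0 : ℝ))).prod ν) ν := Measure.quasiMeasurePreserving_snd
  have hS : NullMeasurableSet {p : ℝ × α | g p.2 ≤ p.1 ∧ p.1 < f p.2}
      ((volume.restrict (Ioi (0 : ℝ))).prod ν) :=
    (nullMeasurableSet_le (hg.comp_quasiMeasurePreserving hq) measurable_fst.aemeasurable).inter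
      (nullMeasurableSet_lt measurable_fst.aemeasurable (hf.comp_quasiMeasurePreserving hq))
  exact (hw.comp_quasiMeasurePreserving hq).indicator₀ hS

theorem nullMeasurableSet_level (hf : AEMeasurable f ν) (hg : AEMeasurable g ν) (s : ℝ) :
    NullMeasurableSet {x | g x ≤ s ∧ s < f x} ν :=
  (nullMeasurableSet_le hg aemeasurable_const).inter (nullMeasurableSet_lt aemeasurable_const hf)

theorem aemeasurable_lintegral_level [SFinite ν] (hf : AEMeasurable f ν) (hg : AEMeasurable g ν)
    (hw : AEMeasurable w ν) :
    AEMeasurable (fun s : ℝ => ∫⁻ x in {x | g x ≤ s ∧ s < f x}, w x ∂ν)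
      (volume.restrict (Ioi (0 : ℝ))) := by
  simp_rw [← lintegral_indicator₀ (nullMeasurableSet_level hf hg _)]
  exact (aemeasurable_level_indicator hf hg hw).lintegral_prod_right'

/-- Layer-cake formula for the difference of two functions. -/
theorem lintegral_lintegral_level [SFinite ν] (hf : AEMeasurable f ν) (hg : AEMeasurable g ν)
    (hw : AEMeasurable w ν) (hg0 : 0 ≤ᵐ[ν] g) :
    ∫⁻ s in Ioi (0 : ℝ), ∫⁻ x in {x | g x ≤ s ∧ s < f x}, w x ∂ν =
      ∫⁻ x, w x * ENNReal.ofReal (f x - g x) ∂ν := by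
  simp_rw [← lintegral_indicator₀ (nullMeasurableSet_level hf hg _)]
  rw [lintegral_lintegral_swap (aemeasurable_level_indicator hf hg hw)]
  refine lintegral_congr_ae ?_
  filter_upwards [hg0] with x hx
  have hx : 0 ≤ g x := hx
  have : (fun s : ℝ => {x | g x ≤ s ∧ s < f x}.indicator w x) =
      (Ico (g x) (f x)).indicator fun _ => w x := by
    ext s
    by_cases h : g x ≤ s ∧ s < f x
    · rw [indicator_of_mem (show x ∈ {x | g x ≤ s ∧ s < f x} from h),
        indicator_of_mem (show s ∈ Ico (g x) (f x) from h)]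
    · rw [indicator_of_notMem (show x ∉ {x | g x ≤ s ∧ s < f x} from h),
        indicator_of_notMem (show s ∉ Ico (g x) (f x) from h)]
  -- If $g(x)=0$ the half-open interval leaves $(0,\infty)$ by its endpoint; the open one does not.
  have hI : Ico (g x) (f x) =ᵐ[volume.restrict (Ioi (0 : ℝ))] Ioo (g x) (f x) :=
    ae_restrict_of_ae Ioo_ae_eq_Ico.symm
  rw [this, lintegral_indicator_const measurableSet_Ico, measure_congr hI,
    Measure.restrict_apply measurableSet_Ioo,
    inter_eq_left.2 (show Ioo (g x) (f x) ⊆ Ioi 0 from fun s hs => lt_of_le_of_lt hx hs.1),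
    Real.volume_Ioo]

/-- Uses $(\sigma(f-g))_+=\sigma_+(f-g)_++\sigma_-(g-f)_+$. Keeping signs apart avoids any
integrability assumption. -/
theorem lintegral_weighted_level [SFinite ν] {σ : α → ℝ} (hf : AEMeasurable f ν) (hg : AEMeasurable g ν)
    (hσ : AEMeasurable σ ν) (hf0 : 0 ≤ᵐ[ν] f) (hg0 : 0 ≤ᵐ[ν] g) :
    ∫⁻ s in Ioi (0 : ℝ), ((∫⁻ x in {x | g x ≤ s ∧ s < f x}, ENNReal.ofReal (σ x) ∂ν) +
        ∫⁻ x in {x | f x ≤ s ∧ s < g x}, ENNReal.ofReal (-σ x) ∂ν) =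
      ∫⁻ x, ENNReal.ofReal (σ x * (f x - g x)) ∂ν := by
  rw [lintegral_add_left' (aemeasurable_lintegral_level hf hg hσ.ennreal_ofReal),
    lintegral_lintegral_level hf hg hσ.ennreal_ofReal hg0,
    lintegral_lintegral_level (w := fun x => ENNReal.ofReal (-σ x)) hg hf
      hσ.neg.ennreal_ofReal hf0,
    ← lintegral_add_left' (f := fun x => ENNReal.ofReal (σ x) * ENNReal.ofReal (f x - g x))
      (hσ.ennreal_ofReal.mul (hf.sub hg).ennreal_ofReal)]
  refine lintegral_congr fun x => ?_
  show ENNReal.ofReal (σ x) * ENNReal.ofReal (f x - g x) +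
    ENNReal.ofReal (-σ x) * ENNReal.ofReal (g x - f x) = ENNReal.ofReal (σ x * (f x - g x))
  rcases le_total 0 (σ x) with h | h
  · rw [ENNReal.ofReal_of_nonpos (neg_nonpos.2 h), zero_mul, add_zero, ENNReal.ofReal_mul h]
  · rw [ENNReal.ofReal_of_nonpos h, zero_mul, zero_add, ← ENNReal.ofReal_mul (neg_nonneg.2 h)]
    congr 1; ring

end LayerCake

/-- The discriminant of $Jl^2-2Xl+K\ge0$ replaces the optimal $l$, so $J=0$ and $K=0$ need no
separate treatment. -/
theorem sq_le_mul_of_forall_amgm {X J K : ℝ} (hX : 0 ≤ X) (hJ : 0 ≤ J) (hK : 0 ≤ K)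
    (h : ∀ l : ℝ, 0 < l → 2 * X ≤ l * J + l⁻¹ * K) : X ^ 2 ≤ J * K := by
  have := discrim_le_zero (a := J) (b := -(2 * X)) (c := K) fun l => by
    rcases le_or_gt l 0 with hl | hl
    · nlinarith [mul_nonneg hJ (mul_self_nonneg l), mul_nonneg hX (neg_nonneg.2 hl)]
    · have h1 := mul_le_mul_of_nonneg_left (h l hl) hl.le
      have h2 : l * (l * J + l⁻¹ * K) = J * (l * l) + K := by field_simp
      linarith
  rw [discrim] at this
  nlinarith

/-- This is $(lhb-1)^2\ge0$ divided by $lh$; the cases $h=0,\infty$ follow the conventions for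
$1/H_\sigma$. -/
theorem ofReal_amgm {b h l : ℝ≥0∞} (hl0 : l ≠ 0) (hl : l ≠ ⊤) (hb : b ≠ ⊤) :
    2 * b ≤ l * (h * b ^ 2) + l⁻¹ * h⁻¹ := by
  rcases eq_or_ne b 0 with rfl | hb0
  · simp
  rcases eq_or_ne h 0 with rfl | h0
  · simp [ENNReal.mul_top (ENNReal.inv_ne_zero.2 hl)]
  rcases eq_or_ne h ⊤ with rfl | ht
  · simp [ENNReal.top_mul (pow_ne_zero 2 hb0), ENNReal.mul_top hl0]
  lift b to ℝ≥0 using hb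
  lift h to ℝ≥0 using ht
  lift l to ℝ≥0 using hl
  have h0' : h ≠ 0 := by exact_mod_cast h0
  have hl0' : l ≠ 0 := by exact_mod_cast hl0
  rw [← ENNReal.coe_inv h0', ← ENNReal.coe_inv hl0']
  norm_cast
  rw [← NNReal.coe_le_coe]
  push_cast
  have hh : 0 < (l : ℝ) * h := by positivity
  have key : (l : ℝ) * (h * b ^ 2) + (l : ℝ)⁻¹ * (h : ℝ)⁻¹ - 2 * b
      = ((l : ℝ) * h * b - 1) ^ 2 / (l * h) := by
    field_simp
    ring
  have := div_nonneg (sq_nonneg ((l : ℝ) * h * b - 1)) hh.le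
  linarith

/-! ### Integration over heights and Cauchy–Schwarz. -/

section Main

variable {d : ℕ} {Ω : Set (EuclideanSpace ℝ (Fin d))} {σ : EuclideanSpace ℝ (Fin d) → ℝ}
  {f q : EuclideanSpace ℝ (Fin d) → ℝ}

namespace Admissible

theorem aemeasurable_beta (hσ : Admissible Ω σ) (hf : NonnegL1 Ω f)
    (q : EuclideanSpace ℝ (Fin d) → ℝ) :
    AEMeasurable (beta Ω f (sigmaRearr Ω σ q)) (volume.restrict (Ioi (0 : ℝ))) := by
  have := aemeasurable_lintegral_level (hσ.aemeasurable_sigmaRearr q) hf.1.aemeasurable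
    (aemeasurable_const (b := (1 : ℝ≥0∞)))
  simp only [setLIntegral_one] at this
  rwa [funext (beta_eq hσ.measurable_domain)]

theorem lintegral_beta (hσ : Admissible Ω σ) (hf : NonnegL1 Ω f) :
    ∫⁻ s in Ioi (0 : ℝ), beta Ω f (sigmaRearr Ω σ q) s =
      ∫⁻ x in Ω, ENNReal.ofReal (sigmaRearr Ω σ q x - f x) := by
  have := lintegral_lintegral_level (hσ.aemeasurable_sigmaRearr q) hf.1.aemeasurable
    (aemeasurable_const (b := (1 : ℝ≥0∞))) hf.2
  simp only [setLIntegral_one, one_mul] at this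
  rwa [funext (beta_eq hσ.measurable_domain)]

theorem aemeasurable_secondDiff (hσ : Admissible Ω σ)
    (hB : ∀ μ : ℝ≥0∞, μ < volume Ω → IntegrableOn σ (sublevel Ω σ μ) volume)
    (hf : NonnegL1 Ω f) (hq : NonnegL1 Ω q) :
    AEMeasurable (fun s => secondDiff Ω σ (distrib Ω q s) (beta Ω f (sigmaRearr Ω σ q) s))
      (volume.restrict (Ioi (0 : ℝ))) := by
  have hb := (hσ.aemeasurable_beta hf q).ennreal_toReal
  have hm : AEMeasurable (fun s => (distrib Ω q s).toReal) (volume.restrict (Ioi (0 : ℝ))) :=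
    antitone_distrib.measurable.ennreal_toReal.aemeasurable
  have h1 := measurable_conjExcess (Ω := Ω) (σ := σ) |>.comp_aemeasurable (hm.add hb)
  have h2 := measurable_conjExcess (Ω := Ω) (σ := σ) |>.comp_aemeasurable (hm.sub hb)
  have h3 := measurable_conjExcess (Ω := Ω) (σ := σ) |>.comp_aemeasurable hm
  have h4 := continuous_neg.measurable.comp_aemeasurable (h3.const_mul (2 : EReal))
  refine ((h1.add h2).add h4).congr ?_
  filter_upwards [self_mem_ae_restrict measurableSet_Ioi] with s hs
  exact (hσ.secondDiff_eq hB (distrib_ne_top hσ.measurable_domain hq hs)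
    (hσ.beta_le_distrib hq f (le_of_lt hs))).symm

theorem lintegral_sigmaRearr (hσ : Admissible Ω σ) (hq : NonnegL1 Ω q) :
    ∫⁻ x in Ω, ENNReal.ofReal (sigmaRearr Ω σ q x) = ∫⁻ x in Ω, ENNReal.ofReal (q x) := by
  rw [lintegral_eq_lintegral_meas_lt _ (Eventually.of_forall (hσ.sigmaRearr_nonneg q))
    (hσ.aemeasurable_sigmaRearr q), lintegral_eq_lintegral_meas_lt _ hq.2 hq.1.aemeasurable]
  refine setLIntegral_congr_fun measurableSet_Ioi fun s hs => ?_
  show _ = _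
  rw [hσ.measure_lt_sigmaRearr hq (le_of_lt hs), distrib_eq hσ.measurable_domain]

theorem integrable_sigmaRearr (hσ : Admissible Ω σ) (hq : NonnegL1 Ω q) :
    IntegrableOn (sigmaRearr Ω σ q) Ω volume := by
  refine (lintegral_ofReal_ne_top_iff_integrable (hσ.aemeasurable_sigmaRearr q).aestronglyMeasurable
    (Eventually.of_forall (hσ.sigmaRearr_nonneg q))).1 ?_
  rw [hσ.lintegral_sigmaRearr hq]
  exact hq.1.lintegral_lt_top.ne

theorem integral_sigmaRearr (hσ : Admissible Ω σ) (hq : NonnegL1 Ω q) :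
    ∫ x in Ω, sigmaRearr Ω σ q x = ∫ x in Ω, q x := by
  rw [integral_eq_lintegral_of_nonneg_ae (Eventually.of_forall (hσ.sigmaRearr_nonneg q))
    (hσ.aemeasurable_sigmaRearr q).aestronglyMeasurable,
    integral_eq_lintegral_of_nonneg_ae hq.2 hq.1.aestronglyMeasurable, hσ.lintegral_sigmaRearr hq]

/-- With $g=q^{*\sigma}$: $|f-g|+g-f=2(g-f)_+$, $\int g=\int q$, and the layer cake turns
$\int(g-f)_+$ into $\int\beta$. -/
theorem normL1_combination (hσ : Admissible Ω σ) (hf : NonnegL1 Ω f) (hq : NonnegL1 Ω q) :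
    normL1 Ω (fun x => f x - sigmaRearr Ω σ q x) + normL1 Ω q - normL1 Ω f =
      2 * (∫⁻ s in Ioi (0 : ℝ), beta Ω f (sigmaRearr Ω σ q) s).toReal := by
  have habs : ∀ {h : EuclideanSpace ℝ (Fin d) → ℝ}, NonnegL1 Ω h →
      normL1 Ω h = ∫ x in Ω, h x := fun hh => integral_congr_ae (by
    filter_upwards [hh.2] with x hx
    exact abs_of_nonneg hx)
  have hg := hσ.integrable_sigmaRearr hq
  have hfg : Integrable (fun x => f x - sigmaRearr Ω σ q x) (volume.restrict Ω) := hf.1.sub hg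
  have hgf : Integrable (fun x => sigmaRearr Ω σ q x - f x) (volume.restrict Ω) := hg.sub hf.1
  have hmax : ∫ x in Ω, max (sigmaRearr Ω σ q x - f x) 0 =
      (∫⁻ x in Ω, ENNReal.ofReal (sigmaRearr Ω σ q x - f x)).toReal := by
    rw [integral_eq_lintegral_of_nonneg_ae (Eventually.of_forall fun x => le_max_right _ _)
      (f := fun x => max (sigmaRearr Ω σ q x - f x) 0) hgf.pos_part.aestronglyMeasurable]
    simp
  rw [hσ.lintegral_beta hf, ← hmax, habs hq, habs hf, ← hσ.integral_sigmaRearr hq, normL1,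
    ← integral_add hfg.abs hg,
    ← integral_sub (f := fun x => |f x - sigmaRearr Ω σ q x| + sigmaRearr Ω σ q x)
      (Integrable.add hfg.abs hg) hf.1, ← integral_const_mul]
  refine integral_congr_ae (Eventually.of_forall fun x => ?_)
  show |f x - sigmaRearr Ω σ q x| + sigmaRearr Ω σ q x - f x =
    2 * max (sigmaRearr Ω σ q x - f x) 0
  rcases abs_cases (f x - sigmaRearr Ω σ q x) with h | h <;>
    rcases max_cases (sigmaRearr Ω σ q x - f x) 0 with h' | h' <;> linarith

/-- The integrated form of `level_inequality`. -/
theorem lintegral_inequality (hd : 1 ≤ d) (hσ : Admissible Ω σ)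
    (hB : ∀ μ : ℝ≥0∞, μ < volume Ω → IntegrableOn σ (sublevel Ω σ μ) volume)
    (hf : NonnegL1 Ω f) (hq : NonnegL1 Ω q)
    (hfin : ∀ᵐ s ∂volume.restrict (Ioi (0 : ℝ)), bigBExt Ω σ (distrib Ω q s) ≠ ⊤) :
    (∫⁻ x in Ω, (-energyDiff Ω σ f q x).toENNReal) +
      ((∫⁻ s in Ioi (0 : ℝ),
        (secondDiff Ω σ (distrib Ω q s) (beta Ω f (sigmaRearr Ω σ q) s)).toENNReal) +
        ∫⁻ s in Ioi (0 : ℝ), (-correction Ω σ f q s).toENNReal) ≤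
    (∫⁻ x in Ω, (energyDiff Ω σ f q x).toENNReal) +
      ∫⁻ s in Ioi (0 : ℝ), (correction Ω σ f q s).toENNReal := by
  have hg := hσ.aemeasurable_sigmaRearr q
  have hg0 : 0 ≤ᵐ[volume.restrict Ω] sigmaRearr Ω σ q :=
    Eventually.of_forall (hσ.sigmaRearr_nonneg q)
  have hpos := lintegral_weighted_level hf.1.aemeasurable hg hσ.measurable_fun hf.2 hg0
  have hneg := lintegral_weighted_level (σ := fun x => -σ x) hf.1.aemeasurable hg
    hσ.measurable_fun.neg hf.2 hg0
  simp only [neg_neg] at hneg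
  have hE : ∫⁻ x in Ω, (energyDiff Ω σ f q x).toENNReal =
      ∫⁻ x in Ω, ENNReal.ofReal (σ x * (f x - sigmaRearr Ω σ q x)) := rfl
  have hE' : ∫⁻ x in Ω, (-energyDiff Ω σ f q x).toENNReal =
      ∫⁻ x in Ω, ENNReal.ofReal (-σ x * (f x - sigmaRearr Ω σ q x)) := by
    refine lintegral_congr fun x => ?_
    rw [energyDiff, ← EReal.coe_neg, EReal.real_coe_toENNReal, neg_mul]
  have hmP := (aemeasurable_lintegral_level hf.1.aemeasurable hg
    hσ.measurable_fun.ennreal_ofReal).add (aemeasurable_lintegral_level hg hf.1.aemeasurable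
    hσ.measurable_fun.neg.ennreal_ofReal)
  have hmN := (aemeasurable_lintegral_level hf.1.aemeasurable hg
    hσ.measurable_fun.neg.ennreal_ofReal).add (aemeasurable_lintegral_level hg hf.1.aemeasurable
    hσ.measurable_fun.ennreal_ofReal)
  rw [hE, hE', ← hpos, ← hneg]
  -- Superadditivity of the lower integral suffices here, so the correction need not be measurable.
  refine (add_le_add_right (le_lintegral_add _ _) _).trans ?_
  refine (lintegral_add_left' hmN _).ge.trans (le_trans ?_ (lintegral_add_left' hmP _).le)
  refine lintegral_mono_ae ?_
  filter_upwards [hfin, self_mem_ae_restrict measurableSet_Ioi] with s hs hs0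
  exact hσ.level_inequality hd hB hf hq hs0 hs

end Admissible

theorem PosPartIntegrable.extIntegral_eq {α : Type*} [MeasurableSpace α] {ν : Measure α}
    {g : α → EReal} (hp : PosPartIntegrable ν g) (hn : ∫⁻ x, (-g x).toENNReal ∂ν ≠ ⊤) :
    extIntegral ν g =
      (((∫⁻ x, (g x).toENNReal ∂ν).toReal - (∫⁻ x, (-g x).toENNReal ∂ν).toReal : ℝ) : EReal) := by
  rw [extIntegral, EReal.coe_sub, EReal.coe_ennreal_toReal hp, EReal.coe_ennreal_toReal hn]

/-- The integrals of `energyDiff` and `correction` are real, and their sum bounds the integral of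
`secondDiff`. -/
theorem Admissible.exists_real_integrals (hd : 1 ≤ d) (hσ : Admissible Ω σ)
    (hB : ∀ μ : ℝ≥0∞, μ < volume Ω → IntegrableOn σ (sublevel Ω σ μ) volume)
    (hf : NonnegL1 Ω f) (hq : NonnegL1 Ω q)
    (hfin : ∀ᵐ s ∂volume.restrict (Ioi (0 : ℝ)), bigBExt Ω σ (distrib Ω q s) ≠ ⊤)
    (hI : PosPartIntegrable (volume.restrict Ω) (energyDiff Ω σ f q))
    (hC : PosPartIntegrable (volume.restrict (Ioi (0 : ℝ))) (correction Ω σ f q)) :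
    ∃ i c : ℝ, extIntegral (volume.restrict Ω) (energyDiff Ω σ f q) = i ∧
      extIntegral (volume.restrict (Ioi (0 : ℝ))) (correction Ω σ f q) = c ∧
      extIntegral (volume.restrict (Ioi (0 : ℝ))) (fun s => -correction Ω σ f q s) = (-c : ℝ) ∧
      (∫⁻ s in Ioi (0 : ℝ),
        (secondDiff Ω σ (distrib Ω q s) (beta Ω f (sigmaRearr Ω σ q) s)).toENNReal) ≠ ⊤ ∧
      (∫⁻ s in Ioi (0 : ℝ),
        (secondDiff Ω σ (distrib Ω q s) (beta Ω f (sigmaRearr Ω σ q) s)).toENNReal).toReal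
        ≤ i + c := by
  have hmain := hσ.lintegral_inequality hd hB hf hq hfin
  have hlt := hmain.trans_lt (ENNReal.add_lt_top.2
    ⟨lt_top_iff_ne_top.2 hI, lt_top_iff_ne_top.2 hC⟩)
  obtain ⟨h1, h23⟩ := ENNReal.add_lt_top.1 hlt
  obtain ⟨h2, h3⟩ := ENNReal.add_lt_top.1 h23
  refine ⟨_, _, hI.extIntegral_eq h1.ne, hC.extIntegral_eq h3.ne, ?_, h2.ne, ?_⟩
  · have h4 : PosPartIntegrable (volume.restrict (Ioi (0 : ℝ)))
      (fun s => -correction Ω σ f q s) := h3.ne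
    rw [h4.extIntegral_eq (by simp only [neg_neg]; exact hC)]
    simp only [neg_neg, neg_sub]
  · rw [← ENNReal.toReal_le_toReal hlt.ne (ENNReal.add_ne_top.2 ⟨hI, hC⟩),
      ENNReal.toReal_add h1.ne h23.ne, ENNReal.toReal_add h2.ne h3.ne,
      ENNReal.toReal_add hI hC] at hmain
    linarith

/-- Finiteness of $B_\sigma(\mu_q(s))$ need not be assumed: $B_\sigma(\mu_q(s))=+\infty$ makes the
second difference $-\infty$. On a set of positive measure this sends the left side to $-\infty$. -/
theorem Admissible.extIntegral_secondDiff_le (hd : 1 ≤ d) (hσ : Admissible Ω σ)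
    (hB : ∀ μ : ℝ≥0∞, μ < volume Ω → IntegrableOn σ (sublevel Ω σ μ) volume)
    (hf : NonnegL1 Ω f) (hq : NonnegL1 Ω q)
    (hI : PosPartIntegrable (volume.restrict Ω) (energyDiff Ω σ f q))
    (hC : PosPartIntegrable (volume.restrict (Ioi (0 : ℝ))) (correction Ω σ f q)) :
    extIntegral (volume.restrict (Ioi (0 : ℝ)))
        (fun s => secondDiff Ω σ (distrib Ω q s) (beta Ω f (sigmaRearr Ω σ q) s))
      + extIntegral (volume.restrict (Ioi (0 : ℝ))) (fun s => -correction Ω σ f q s)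
      ≤ extIntegral (volume.restrict Ω) (energyDiff Ω σ f q) := by
  have hmeas := hσ.aemeasurable_secondDiff hB hf hq
  by_cases hN : ∫⁻ s in Ioi (0 : ℝ),
      (-secondDiff Ω σ (distrib Ω q s) (beta Ω f (sigmaRearr Ω σ q) s)).toENNReal = ⊤
  · rw [extIntegral, hN, EReal.coe_ennreal_top, EReal.sub_top, EReal.bot_add]
    exact bot_le
  have hfin : ∀ᵐ s ∂volume.restrict (Ioi (0 : ℝ)), bigBExt Ω σ (distrib Ω q s) ≠ ⊤ := by
    filter_upwards [ae_lt_top' (continuous_neg.measurable.comp_aemeasurable hmeas).ereal_toENNReal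
      hN] with s hs htop
    refine hs.ne ?_
    show (-secondDiff Ω σ (distrib Ω q s) (beta Ω f (sigmaRearr Ω σ q) s)).toENNReal = ⊤
    rw [secondDiff, htop, EReal.mul_top_of_pos (by norm_num), EReal.sub_top, EReal.neg_bot,
      EReal.toENNReal_top]
  obtain ⟨i, c, hi, -, hc, hJ, hle⟩ := hσ.exists_real_integrals hd hB hf hq hfin hI hC
  rw [hi, hc, PosPartIntegrable.extIntegral_eq hJ hN, ← EReal.coe_add, EReal.coe_le_coe_iff]
  linarith [ENNReal.toReal_nonneg (a := ∫⁻ s in Ioi (0 : ℝ),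
    (-secondDiff Ω σ (distrib Ω q s) (beta Ω f (sigmaRearr Ω σ q) s)).toENNReal)]

theorem distrib_pos_of_lt (hΩ : NullMeasurableSet Ω volume) (hq : NonnegL1 Ω q) {t : ℝ}
    (h : ENNReal.ofReal t < eLpNorm q ⊤ (volume.restrict Ω)) : 0 < distrib Ω q t := by
  by_contra h0
  have h0 : distrib Ω q t = 0 := by simpa using h0
  rw [distrib_eq hΩ] at h0
  refine h.not_ge ?_
  rw [eLpNorm_exponent_top]
  refine eLpNormEssSup_le_of_ae_enorm_bound ?_
  have h0' : ∀ᵐ x ∂volume.restrict Ω, ¬ t < q x := by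
    rw [ae_iff]; simpa using h0
  filter_upwards [h0', hq.2] with x hx hx0
  rw [Real.enorm_of_nonneg hx0]
  exact ENNReal.ofReal_le_ofReal (not_lt.1 hx)

theorem distrib_eq_zero_of_le (hΩ : NullMeasurableSet Ω volume) {t : ℝ} (ht : 0 ≤ t)
    (h : eLpNorm q ⊤ (volume.restrict Ω) ≤ ENNReal.ofReal t) : distrib Ω q t = 0 := by
  have h0 : ∀ᵐ x ∂volume.restrict Ω, ¬ t < q x := by
    rw [eLpNorm_exponent_top] at h
    filter_upwards [enorm_ae_le_eLpNormEssSup q (volume.restrict Ω)] with x hx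
    have := hx.trans h
    rw [Real.enorm_eq_ofReal_abs, ENNReal.ofReal_le_ofReal_iff ht] at this
    exact not_lt.2 ((le_abs_self _).trans this)
  rw [distrib_eq hΩ]
  rw [ae_iff] at h0
  simpa using h0

theorem measurableSet_level_range (c : ℝ≥0∞) :
    MeasurableSet {t : ℝ | 0 < t ∧ ENNReal.ofReal t < c} :=
  measurableSet_Ioi.inter (measurableSet_lt ENNReal.measurable_ofReal measurable_const)

namespace Admissible

theorem volume_pos (hσ : Admissible Ω σ) : 0 < volume Ω := pos_iff_ne_zero.2 hσ.volume_ne_zero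

/-- Where $B_\sigma(\mu_q)=+\infty$ below $\|q\|_\infty$, one has $H_\sigma\le0$ and
$1/H_\sigma=+\infty$, which $K<\infty$ allows only on a null set. Above $\|q\|_\infty$ the argument
is $0$. -/
theorem ae_bigBExt_ne_top (hσ : Admissible Ω σ)
    (hB : ∀ μ : ℝ≥0∞, μ < volume Ω → IntegrableOn σ (sublevel Ω σ μ) volume)
    (hq : NonnegL1 Ω q) (hK : bigK Ω σ q ≠ ⊤) :
    ∀ᵐ s ∂volume.restrict (Ioi (0 : ℝ)), bigBExt Ω σ (distrib Ω q s) ≠ ⊤ := by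
  classical
  set S := {t : ℝ | 0 < t ∧ ENNReal.ofReal t < eLpNorm q ⊤ (volume.restrict Ω)}
  have hS : MeasurableSet S := measurableSet_level_range _
  -- A measurable minorant of $1/H_\sigma(\mu_q)$ on $S$; measurability of $1/H_\sigma(\mu_q)$
  -- itself is not established.
  set φ : ℝ → ℝ≥0∞ := fun s => if conjExcess Ω σ (distrib Ω q s).toReal = ⊤ then ⊤ else 0
  have hφ : Measurable φ := by
    refine Measurable.ite ?_ measurable_const measurable_const
    exact (measurable_conjExcess.comp antitone_distrib.measurable.ennreal_toReal)
      (measurableSet_singleton ⊤)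
  have hle : ∫⁻ s in S, φ s ≤ ∫⁻ t in S, ((bigH Ω σ (distrib Ω q t)).toENNReal)⁻¹ := by
    refine setLIntegral_mono_ae' hS (Eventually.of_forall fun t ht => ?_)
    simp only [φ]
    split_ifs with h
    · have hm := distrib_pos_of_lt hσ.measurable_domain hq ht.2
      have hmt := distrib_ne_top hσ.measurable_domain hq ht.1
      rw [← hσ.bigBExt_eq hB hmt] at h
      have hsec : secondDiff Ω σ (distrib Ω q t) (distrib Ω q t) = ⊥ := by
        rw [secondDiff, h, EReal.mul_top_of_pos (by norm_num), EReal.sub_top]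
      have hH : bigH Ω σ (distrib Ω q t) ≤ 0 := by
        refine (iInf₂_le (distrib Ω q t) ⟨hm, le_rfl⟩).trans ?_
        rw [hsec]
        exact EReal.div_nonpos_of_nonpos_of_nonneg bot_le
          (pow_nonneg (EReal.coe_ennreal_nonneg _) 2)
      rw [EReal.toENNReal_of_nonpos hH, ENNReal.inv_zero]
    · exact zero_le
  have hfin : ∫⁻ s in S, φ s ≠ ⊤ := by
    refine ne_top_of_le_ne_top (fun h => hK ?_) hle
    rw [bigK, h]
    exact ENNReal.mul_top (by norm_num)
  have hae := (ae_restrict_iff' hS).1 (ae_lt_top' hφ.aemeasurable hfin)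
  rw [ae_restrict_iff' measurableSet_Ioi]
  filter_upwards [hae] with s hs hs0
  have hmt := distrib_ne_top hσ.measurable_domain hq hs0
  by_cases hsS : s ∈ S
  · have := hs hsS
    rw [hσ.bigBExt_eq hB hmt]
    intro htop
    simp [φ, htop] at this
  · have hle : eLpNorm q ⊤ (volume.restrict Ω) ≤ ENNReal.ofReal s := by
      by_contra! h
      exact hsS ⟨hs0, h⟩
    rw [distrib_eq_zero_of_le hσ.measurable_domain (le_of_lt hs0) hle, bigBExt,
      if_pos hσ.volume_pos]
    exact EReal.coe_ne_top _

theorem bigH_mul_sq_le {m b : ℝ≥0∞} (hb0 : b ≠ 0) (hbm : b ≤ m) (hm : m ≠ ⊤) :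
    (bigH Ω σ m).toENNReal * b ^ 2 ≤ (secondDiff Ω σ m b).toENNReal := by
  have hbt : b ≠ ⊤ := ne_top_of_le_ne_top hm hbm
  have hsq : (b : EReal) ^ 2 = ((b ^ 2 : ℝ≥0∞) : EReal) := by
    rw [pow_two, pow_two, EReal.coe_ennreal_mul]
  have h : bigH Ω σ m ≤ secondDiff Ω σ m b / (b : EReal) ^ 2 :=
    iInf₂_le b ⟨pos_iff_ne_zero.2 hb0, hbm⟩
  have hpos : (0 : EReal) < ((b ^ 2 : ℝ≥0∞) : EReal) :=
    EReal.coe_ennreal_pos.2 (pos_iff_ne_zero.2 (pow_ne_zero 2 hb0))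
  rw [hsq, EReal.le_div_iff_mul_le hpos
    (EReal.coe_ennreal_eq_top_iff.not.2 (ENNReal.pow_ne_top hbt))] at h
  have := EReal.toENNReal_le_toENNReal h
  rwa [EReal.toENNReal_mul' hpos.le, EReal.toENNReal_coe] at this

/-- Cauchy–Schwarz in the form $2\int\beta\le l\int D+l^{-1}\int 1/H_\sigma$ for all $l>0$, where
$D$ is the second difference; only $D$ has to be measurable. -/
theorem sq_lintegral_beta_le (hσ : Admissible Ω σ)
    (hB : ∀ μ : ℝ≥0∞, μ < volume Ω → IntegrableOn σ (sublevel Ω σ μ) volume)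
    (hf : NonnegL1 Ω f) (hq : NonnegL1 Ω q) (hK : bigK Ω σ q ≠ ⊤)
    (hJ : (∫⁻ s in Ioi (0 : ℝ),
        (secondDiff Ω σ (distrib Ω q s) (beta Ω f (sigmaRearr Ω σ q) s)).toENNReal) ≠ ⊤) :
    (2 * (∫⁻ s in Ioi (0 : ℝ), beta Ω f (sigmaRearr Ω σ q) s).toReal) ^ 2 ≤
      (bigK Ω σ q).toReal * (∫⁻ s in Ioi (0 : ℝ),
        (secondDiff Ω σ (distrib Ω q s) (beta Ω f (sigmaRearr Ω σ q) s)).toENNReal).toReal := by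
  set S := {t : ℝ | 0 < t ∧ ENNReal.ofReal t < eLpNorm q ⊤ (volume.restrict Ω)}
  have hS : MeasurableSet S := measurableSet_level_range _
  have hSI : S ⊆ Ioi 0 := fun t ht => ht.1
  set b := beta Ω f (sigmaRearr Ω σ q)
  set m := distrib Ω q
  set D := fun s => (secondDiff Ω σ (m s) (b s)).toENNReal
  set L := fun s => ((bigH Ω σ (m s)).toENNReal)⁻¹
  have hDm : AEMeasurable D (volume.restrict (Ioi (0 : ℝ))) :=
    (hσ.aemeasurable_secondDiff hB hf hq).ereal_toENNReal
  have hLt : ∫⁻ s in S, L s ≠ ⊤ := fun h => hK (by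
    rw [bigK]
    show 4 * ∫⁻ s in S, L s = ⊤
    rw [h]; exact ENNReal.mul_top (by norm_num))
  -- Above $\|q\|_\infty$, $\beta\le\mu_q=0$.
  have hbS : ∫⁻ s in Ioi (0 : ℝ), b s = ∫⁻ s in S, b s := by
    have : ∫⁻ s in Ioi (0 : ℝ), S.indicator b s = ∫⁻ s in S, b s := by
      rw [setLIntegral_indicator hS, inter_eq_left.2 hSI]
    rw [← this]
    refine setLIntegral_congr_fun measurableSet_Ioi fun s hs0 => ?_
    by_cases hsS : s ∈ S
    · rw [indicator_of_mem hsS]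
    · have hle : eLpNorm q ⊤ (volume.restrict Ω) ≤ ENNReal.ofReal s := by
        by_contra! h
        exact hsS ⟨hs0, h⟩
      rw [indicator_of_notMem hsS]
      exact le_zero_iff.1 ((hσ.beta_le_distrib hq f (le_of_lt hs0)).trans_eq
        (distrib_eq_zero_of_le hσ.measurable_domain (le_of_lt hs0) hle))
  have hamgm : ∀ l : ℝ, 0 < l → 2 * ∫⁻ s in Ioi (0 : ℝ), b s ≤
      ENNReal.ofReal l * (∫⁻ s in Ioi (0 : ℝ), D s) +
        (ENNReal.ofReal l)⁻¹ * ∫⁻ s in S, L s := fun l hl => by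
    have hl0 : ENNReal.ofReal l ≠ 0 := by simpa using hl
    have hlt : ENNReal.ofReal l ≠ ⊤ := ENNReal.ofReal_ne_top
    calc 2 * ∫⁻ s in Ioi (0 : ℝ), b s = ∫⁻ s in S, 2 * b s := by
          rw [hbS, lintegral_const_mul' _ _ (by norm_num)]
      _ ≤ ∫⁻ s in S, (ENNReal.ofReal l * D s + (ENNReal.ofReal l)⁻¹ * L s) := by
          refine setLIntegral_mono_ae' hS (Eventually.of_forall fun s hs => ?_)
          have hmt := distrib_ne_top hσ.measurable_domain hq hs.1
          have hbm : b s ≤ m s := hσ.beta_le_distrib hq f (le_of_lt hs.1)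
          rcases eq_or_ne (b s) 0 with h0 | h0
          · rw [h0]; simp
          refine (ofReal_amgm (h := (bigH Ω σ (m s)).toENNReal) hl0 hlt
             (ne_top_of_le_ne_top hmt hbm)).trans ?_
          exact add_le_add_left (mul_le_mul_right (bigH_mul_sq_le h0 hbm hmt) _) _
      _ = ENNReal.ofReal l * (∫⁻ s in S, D s) + (ENNReal.ofReal l)⁻¹ * ∫⁻ s in S, L s := by
          rw [lintegral_add_left' ((hDm.mono_measure (Measure.restrict_mono hSI le_rfl)).const_mul _),
            lintegral_const_mul' _ _ hlt, lintegral_const_mul' _ _ (ENNReal.inv_ne_top.2 hl0)]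
      _ ≤ _ := by
          gcongr
  have hX : ∫⁻ s in Ioi (0 : ℝ), b s ≠ ⊤ := by
    rw [hσ.lintegral_beta hf]
    exact ((hσ.integrable_sigmaRearr hq).sub hf.1).lintegral_lt_top.ne
  have hkey := sq_le_mul_of_forall_amgm (X := (∫⁻ s in Ioi (0 : ℝ), b s).toReal)
    (J := (∫⁻ s in Ioi (0 : ℝ), D s).toReal) (K := (∫⁻ s in S, L s).toReal)
    ENNReal.toReal_nonneg ENNReal.toReal_nonneg ENNReal.toReal_nonneg fun l hl => by
      have hl0 : ENNReal.ofReal l ≠ 0 := by simpa using hl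
      have h1 : ENNReal.ofReal l * (∫⁻ s in Ioi (0 : ℝ), D s) ≠ ⊤ :=
        ENNReal.mul_ne_top ENNReal.ofReal_ne_top hJ
      have h2 : (ENNReal.ofReal l)⁻¹ * ∫⁻ s in S, L s ≠ ⊤ :=
        ENNReal.mul_ne_top (ENNReal.inv_ne_top.2 hl0) hLt
      have := ENNReal.toReal_mono (ENNReal.add_ne_top.2 ⟨h1, h2⟩) (hamgm l hl)
      rwa [ENNReal.toReal_add h1 h2, ENNReal.toReal_mul, ENNReal.toReal_mul, ENNReal.toReal_mul,
        ENNReal.toReal_inv, ENNReal.toReal_ofReal hl.le, ENNReal.toReal_ofNat] at this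
  have hKr : (bigK Ω σ q).toReal = 4 * (∫⁻ s in S, L s).toReal := by
    rw [bigK, ENNReal.toReal_mul, ENNReal.toReal_ofNat]
  rw [hKr]
  linarith

theorem refined_inequality (hd : 1 ≤ d) (hσ : Admissible Ω σ)
    (hB : ∀ μ : ℝ≥0∞, μ < volume Ω → IntegrableOn σ (sublevel Ω σ μ) volume)
    (hf : NonnegL1 Ω f) (hq : NonnegL1 Ω q) (hK : bigK Ω σ q ≠ ⊤)
    (hI : PosPartIntegrable (volume.restrict Ω) (energyDiff Ω σ f q))
    (hC : PosPartIntegrable (volume.restrict (Ioi (0 : ℝ))) (correction Ω σ f q)) :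
    (((normL1 Ω (fun x => f x - sigmaRearr Ω σ q x) + normL1 Ω q - normL1 Ω f) ^ 2 : ℝ) : EReal)
      ≤ (bigK Ω σ q : EReal) *
        (extIntegral (volume.restrict Ω) (energyDiff Ω σ f q)
          + extIntegral (volume.restrict (Ioi (0 : ℝ))) (correction Ω σ f q)) := by
  have hfin := hσ.ae_bigBExt_ne_top hB hq hK
  obtain ⟨i, c, hi, hc, -, hJ, hle⟩ := hσ.exists_real_integrals hd hB hf hq hfin hI hC
  rw [hi, hc, hσ.normL1_combination hf hq, ← EReal.coe_ennreal_toReal hK, ← EReal.coe_add,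
    ← EReal.coe_mul, EReal.coe_le_coe_iff]
  exact (hσ.sq_lintegral_beta_le hB hf hq hK hJ).trans
    (mul_le_mul_of_nonneg_left hle ENNReal.toReal_nonneg)

end Admissible

theorem correction_self (s : ℝ) : correction Ω σ f f s = 0 := by
  have : beta Ω (rearr Ω f) (rearr Ω f) s = 0 := by
    rw [beta]
    convert measure_empty (μ := (volume : Measure (EuclideanSpace ℝ (Fin d))))
    ext x
    simp only [mem_ofPred_eq, mem_empty_iff_false, iff_false]
    exact fun h => h.2.2.not_ge h.2.1
  rw [correction, this]
  simp

end Main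

end RefinedHL

theorem theorem1 {d : ℕ} (hd : 1 ≤ d) (Ω : Set (EuclideanSpace ℝ (Fin d)))
    (σ : EuclideanSpace ℝ (Fin d) → ℝ) (hσ : Admissible Ω σ)
    (hB : ∀ μ : ℝ≥0∞, μ < volume Ω → IntegrableOn σ (sublevel Ω σ μ) volume) :
    -- convexity of `B_σ` on `[0, meas Ω)`
    ConvexOn ℝ {m : ℝ | 0 ≤ m ∧ ENNReal.ofReal m < volume Ω}
        (fun m => bigB Ω σ (ENNReal.ofReal m)) ∧
    -- the refined inequality for two functions; an integral on the right whose positive part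
    -- diverges would be `+∞` or undefined
    (∀ q : EuclideanSpace ℝ (Fin d) → ℝ, NonnegL1 Ω q → ¬ (q =ᵐ[volume.restrict Ω] 0) →
      bigK Ω σ q ≠ ⊤ →
      ∀ f : EuclideanSpace ℝ (Fin d) → ℝ, NonnegL1 Ω f →
        PosPartIntegrable (volume.restrict Ω) (energyDiff Ω σ f q) →
        PosPartIntegrable (volume.restrict (Ioi (0 : ℝ))) (correction Ω σ f q) →
        (((normL1 Ω (fun x => f x - sigmaRearr Ω σ q x) + normL1 Ω q - normL1 Ω f) ^ 2 : ℝ) : EReal)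
          ≤ (bigK Ω σ q : EReal) *
            (extIntegral (volume.restrict Ω) (energyDiff Ω σ f q)
              + extIntegral (volume.restrict (Ioi (0 : ℝ))) (correction Ω σ f q))) ∧
    -- the case `q = f`
    (∀ f : EuclideanSpace ℝ (Fin d) → ℝ, NonnegL1 Ω f → bigK Ω σ f ≠ ⊤ →
        PosPartIntegrable (volume.restrict Ω) (energyDiff Ω σ f f) →
        (((normL1 Ω (fun x => f x - sigmaRearr Ω σ f x)) ^ 2 : ℝ) : EReal)
          ≤ (bigK Ω σ f : EReal) * extIntegral (volume.restrict Ω) (energyDiff Ω σ f f)) ∧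
    -- the inequality without finiteness of the constant
    (∀ f q : EuclideanSpace ℝ (Fin d) → ℝ, NonnegL1 Ω f → NonnegL1 Ω q →
        PosPartIntegrable (volume.restrict Ω) (energyDiff Ω σ f q) →
        PosPartIntegrable (volume.restrict (Ioi (0 : ℝ))) (correction Ω σ f q) →
        extIntegral (volume.restrict (Ioi (0 : ℝ)))
            (fun s => secondDiff Ω σ (distrib Ω q s) (beta Ω f (sigmaRearr Ω σ q) s))
          + extIntegral (volume.restrict (Ioi (0 : ℝ))) (fun s => -correction Ω σ f q s)
          ≤ extIntegral (volume.restrict Ω) (energyDiff Ω σ f q)) := by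
  refine ⟨hσ.convexOn_bigB hB, fun q hq _ hK f hf hI hC => hσ.refined_inequality hd hB hf hq hK hI hC,
    fun f hf hK hI => ?_, fun f q hf hq hI hC => hσ.extIntegral_secondDiff_le hd hB hf hq hI hC⟩
  -- For $q=f$ both $\beta$'s vanish, and $0\cdot(\pm\infty)=0$ removes $C$.
  have hcorr : correction Ω σ f f = fun _ => 0 := funext correction_self
  have := hσ.refined_inequality hd hB hf hf hK hI (by simp [PosPartIntegrable, hcorr])
  simpa [hcorr, extIntegral] using this
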